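/- **Setup.** Let $H$ be a real Hilbert space with a norm $\|\cdot\|$ equivalent to, but not necessarily equal to, its Hilbert norm, and let $\|x\|_*=\max_{\|y\|=1}\langle x,y\rangle$ be the dual norm. Let $\Theta\subseteq H$ be closed and convex with $\|\theta\|\le R_\Theta$ for all $\theta\in\Theta$. For losses $f_1,\dots,f_N$ and decisions $\theta_1,\dots,\theta_N$ put $\mathrm{Regret}(f_n)=\sum_{n=1}^N f_n(\theta_n)-\min_{\theta\in\Theta}\sum_{n=1}^N f_n(\theta)$. A function $f:H\to\mathbb R$ is *CSN* if it is convex, non-negative and $\beta$-smooth, i.e. differentiable with $\|\nabla f(x)-\nabla f(y)\|_*\le\beta\|x-y\|$ for all $x,y\in H$; here $\beta>0$. An online algorithm $\mathcal A$ maps a stepsize $\eta>0$ and the losses $f_1,\dots,f_{n-1}$ seen so far to a decision $\theta_n\in\Theta$. It is *admissible* with constant $R_{\mathcal A}\in[0,\infty)$ if for all $\eta>0$, all $N$ and all differentiable convex $f_1,\dots,f_N:H\to\mathbb R$, $$\mathrm{Regret}(f_n)\le\mathrm{Regret}(\langle\nabla f_n(\theta_n),\cdot\rangle)\le\tfrac1\eta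 R_{\mathcal A}^2+\tfrac\eta2\sum_{n=1}^N\|\nabla f_n(\theta_n)\|_*^2 .$$ *Online imitation learning:* in round $n=1,\dots,N$ the algorithm $\mathcal A$ plays $\theta_n$, computed from the sampled losses $\hat l_1,\dots,\hat l_{n-1}$; an expected loss $l_n:H\to\mathbb R$ is determined by the information $\mathcal F_{n-1}$ available before round $n$; a random loss $\hat l_n:H\to\mathbb R$ is then sampled with $\mathbb E[\hat l_n(\theta)\mid\mathcal F_{n-1}]=l_n(\theta)$ for every $\theta\in\Theta$, and is revealed to $\mathcal A$. (Losses, their gradients and the decisions are measurable with respect to the corresponding information.) Put $$\hat\epsilon=\tfrac1N\min_{\theta\in\Theta}\sum_{n=1}^N\hat l_n(\theta),\qquad \epsilon=\tfrac1N\min_{\theta\in\Theta}\sum_{n=1}^N l_n(\theta).$$ **Theorem.** Suppose that all $\hat l_n$ and $l_n$ are CSN, that $\mathcal A$ is admissible with constant $R_{\mathcal A}$, that $\hat E$ is a constant with $\hat\epsilon\le\hat E$ almost surely, that $\mathcal A$ is run with stepsize $$\eta=\frac1{2\left(\beta+\sqrt{\beta^2+\tfrac12\beta N\hat E R_{\mathcal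 A}^{-2}}\right)}$$ (if $R_{\mathcal A}=0$, which forces $\Theta$ to be a single point, $R_{\mathcal A}^{-2}$ is read as $0$), and that there is $G\in[0,\infty)$ with $\|\nabla\hat l_n(\theta)\|_*\le G$ for all $n$ and all $\theta\in\Theta$. Then for every $N\ge1$ and every $0<\delta<1/e$, with probability at least $1-\delta$, $$\frac1N\sum_{n=1}^N l_n(\theta_n)-\epsilon\;\le\;K\left(\frac{C\beta R^2}{N}+\sqrt{\frac{C\beta R^2(\hat E+\epsilon)}{N}}\right),$$ where $R=\max(1,R_\Theta,R_{\mathcal A})$ and $C=\log(1/\delta)\,\max\bigl(1,\log(GRN)\bigr)$; so $C=\log(1/\delta)\log(GRN)$ as soon as $GRN\ge e$. The constant $K$ depends only on a number $B$ such that there exists a differentiable function $h:H\to\mathbb R$, 1-strongly convex with respect to $\|\cdot\|$, with Bregman divergence $h(x)-h(y)-\langle\nabla h(y),x-y\rangle\le B^2$ whenever $\|x\|=\|y\|=1$ (for the Hilbert norm, $h=\frac12\|\cdot\|^2$ and $B=\sqrt2$). -/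

import Mathlib

open MeasureTheory

noncomputable section

/-- `p` is a norm on the Hilbert space `H`, possibly different from the one induced by the inner
product, but equivalent to it (automatic in finite dimension), so that its dual norm is finite. -/
def IsEquivalentNorm {H : Type*} [NormedAddCommGroup H] [InnerProductSpace ℝ H]
    (p : Seminorm ℝ H) : Prop :=
  ∃ c > (0 : ℝ), ∃ C : ℝ, ∀ x : H, c * ‖x‖ ≤ p x ∧ p x ≤ C * ‖x‖

/-- The dual norm `‖x‖_* = max_{‖y‖ = 1} ⟪x, y⟫` of the norm `p`. -/
def dualNorm {H : Type*} [NormedAddCommGroup H] [InnerProductSpace ℝ H]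
    (p : Seminorm ℝ H) (x : H) : ℝ :=
  sSup ((fun y : H => inner ℝ x y) '' {y : H | p y = 1})

/-- Convex, `β`-smooth (with respect to `p` and its dual norm) and non-negative functions. -/
structure CSN {H : Type*} [NormedAddCommGroup H] [InnerProductSpace ℝ H] [CompleteSpace H]
    (p : Seminorm ℝ H) (β : ℝ) (f : H → ℝ) : Prop where
  convex : ConvexOn ℝ Set.univ f
  differentiable : Differentiable ℝ f
  smooth : ∀ x y : H, dualNorm p (gradient f x - gradient f y) ≤ β * p (x - y)
  nonneg : ∀ x : H, 0 ≤ f x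

/-- The Bregman divergence `D_h(x‖y) = h(x) - h(y) - ⟪∇h(y), x - y⟫`. -/
def bregman {H : Type*} [NormedAddCommGroup H] [InnerProductSpace ℝ H] [CompleteSpace H]
    (h : H → ℝ) (x y : H) : ℝ :=
  h x - h y - inner ℝ (gradient h y) (x - y)

/-- The geometric constant of the normed space `(H, p)` is at most `B`: there is a differentiable
function `h` that is 1-strongly convex with respect to `p` and whose Bregman divergence is at most
`B ^ 2` on the unit sphere of `p`. (For the Hilbert norm, `h = ‖·‖ ^ 2 / 2` and `B ^ 2 = 2`.) -/
def HasGeometricConstant {H : Type*} [NormedAddCommGroup H] [InnerProductSpace ℝ H]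
    [CompleteSpace H] (p : Seminorm ℝ H) (B : ℝ) : Prop :=
  ∃ h : H → ℝ, Differentiable ℝ h ∧
    (∀ x y : H, (1 / 2) * p (x - y) ^ 2 ≤ bregman h x y) ∧
    (∀ x y : H, p x = 1 → p y = 1 → bregman h x y ≤ B ^ 2)

/-- The minimum over `Θ` of the cumulative loss `∑_{n < N} f_n`. -/
def minTotalLoss {H : Type*} (Θ : Set H) (N : ℕ) (f : ℕ → H → ℝ) : ℝ :=
  sInf ((fun x : H => ∑ n ∈ Finset.range N, f n x) '' Θ)

/-- The bias of the decision set: the minimum average loss over `Θ`. -/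
def bias {H : Type*} (Θ : Set H) (N : ℕ) (f : ℕ → H → ℝ) : ℝ :=
  (1 / (N : ℝ)) * minTotalLoss Θ N f

/-- The regret of the decisions `θ` on the losses `f` over `N` rounds. -/
def regret {H : Type*} (Θ : Set H) (N : ℕ) (f : ℕ → H → ℝ) (θ : ℕ → H) : ℝ :=
  ∑ n ∈ Finset.range N, f n (θ n) - minTotalLoss Θ N f

/-- An online algorithm maps a stepsize and the list of the loss functions revealed so far to
the next decision. -/
abbrev OnlineAlgorithm (H : Type*) := ℝ → List (H → ℝ) → H

/-- The decision of `A` with stepsize `η` in round `n` (rounds are numbered from `0`) when the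
loss functions are `f 0, f 1, …`: it only uses `f 0, …, f (n - 1)`. -/
def OnlineAlgorithm.decision {H : Type*} (A : OnlineAlgorithm H) (η : ℝ) (f : ℕ → H → ℝ)
    (n : ℕ) : H :=
  A η ((List.range n).map f)

/-- `A` is admissible for `Θ` with constant `R_A`: its decisions lie in `Θ` and, for every
stepsize `η > 0` and all differentiable convex losses,
`Regret(f_n) ≤ Regret(⟪∇f_n(θ_n), ·⟫) ≤ R_A² / η + (η / 2) ∑ ‖∇f_n(θ_n)‖_*²`. -/
structure IsAdmissible {H : Type*} [NormedAddCommGroup H] [InnerProductSpace ℝ H]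
    [CompleteSpace H] (p : Seminorm ℝ H) (Θ : Set H) (A : OnlineAlgorithm H) (RA : ℝ) : Prop where
  mem : ∀ η > (0 : ℝ), ∀ L : List (H → ℝ), A η L ∈ Θ
  regret_le : ∀ η > (0 : ℝ), ∀ f : ℕ → H → ℝ,
    (∀ n, ConvexOn ℝ Set.univ (f n) ∧ Differentiable ℝ (f n)) → ∀ N : ℕ,
      regret Θ N f (A.decision η f) ≤
        regret Θ N (fun n x => inner ℝ (gradient (f n) (A.decision η f n)) x)
          (A.decision η f) ∧
      regret Θ N (fun n x => inner ℝ (gradient (f n) (A.decision η f n)) x)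
          (A.decision η f) ≤
        (1 / η) * RA ^ 2 +
          (η / 2) * ∑ n ∈ Finset.range N, dualNorm p (gradient (f n) (A.decision η f n)) ^ 2

/-- `N` rounds of online imitation learning with the online algorithm `A` run with stepsize `η` on
the sampled losses `emloss`. `ℱ n` is the information available before the samples of round `n`
(numbered from `0`) are drawn. The decision `θ_n` and the expected loss `exloss n` are determined
by that information, and `emloss n` is an unbiased estimate of `exloss n` given it. -/
structure OnlineIL {H Ω : Type*} [NormedAddCommGroup H] [InnerProductSpace ℝ H] [CompleteSpace H]
    {mΩ : MeasurableSpace Ω} (μ : Measure Ω) (ℱ : Filtration ℕ mΩ) (Θ : Set H)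
    (A : OnlineAlgorithm H) (η : ℝ) (N : ℕ) (emloss exloss : ℕ → Ω → H → ℝ) : Prop where
  decision_meas : ∀ n < N,
    StronglyMeasurable[ℱ n] (fun ω => A.decision η (fun i => emloss i ω) n)
  emloss_meas : ∀ n < N, ∀ x : H, StronglyMeasurable[ℱ (n + 1)] (fun ω => emloss n ω x)
  emgrad_meas : ∀ n < N, ∀ x : H,
    StronglyMeasurable[ℱ (n + 1)] (fun ω => gradient (emloss n ω) x)
  exloss_meas : ∀ n < N, ∀ x : H, StronglyMeasurable[ℱ n] (fun ω => exloss n ω x)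
  exgrad_meas : ∀ n < N, ∀ x : H, StronglyMeasurable[ℱ n] (fun ω => gradient (exloss n ω) x)
  integrable : ∀ n < N, ∀ x ∈ Θ, Integrable (fun ω => emloss n ω x) μ
  unbiased : ∀ n < N, ∀ x ∈ Θ,
    (fun ω => exloss n ω x) =ᵐ[μ] μ[fun ω => emloss n ω x | ℱ n]

/-- The stepsize `1 / (2 (β + √(β² + β N Ê R_A⁻² / 2)))`. -/
def stepsize (β : ℝ) (N : ℕ) (Ehat RA : ℝ) : ℝ :=
  1 / (2 * (β + √(β ^ 2 + (1 / 2) * β * N * Ehat * (RA ^ 2)⁻¹)))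

end

/-!
The excess loss is split at the gradient noise. By convexity, for every `x ∈ Θ`,

`∑ (l n (θ n) - l n x) ≤ ∑ ⟪∇l̂ n (θ n), θ n - x⟫ + ∑ ⟪ξ n, θ n - x⟫`,
`ξ n = ∇l n (θ n) - ∇l̂ n (θ n)`.

The first sum is a linear regret. Gradients of smooth non-negative functions are self-bounding,
`‖∇f‖_* ^ 2 ≤ 4 β f` (`CSN.dualNorm_gradient_sq_le`), so with the tuned stepsize admissibility
bounds, almost surely, this regret by `O(√(β R² D))` and the total sampled loss by `10 D`, where
`D = N Ê + β R² log (1 / δ)` (`IsAdmissible.regret_stepsize_le`).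

The second sum has to be bounded for all `x` at once, because the minimiser of the expected losses
is random. Let `y n` be the decisions of follow-the-regularised-leader on the linear losses `ξ`,
regularised by the strongly convex function behind the geometric constant. Then
`∑ ⟪ξ n, y n - x⟫` is a deterministic regret (`HasGeometricConstant.exists_ftrl`), and what remains,
`∑ ⟪ξ n, θ n - y n⟫`, is a scalar martingale. (The given algorithm cannot supply `y`, since it need
not be measurable; the decision rule of follow-the-regularised-leader is continuous.) The martingale
property uses unbiasedness at points of `Θ` only, through difference quotients inside `Θ`
(`condExp_inner_gradient_sub`). The squared increments are at most of
order `β R² (l n (θ n) + l̂ n (θ n))`, so the inequality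
`exp (x - x²) ≤ 1 + x + x²` gives a self-normalised exponential bound without any term in the size
of the gradients (`integral_exp_sum_le_one`). This yields, for each fixed scale
(`OnlineIL.measure_excess_le`), a self-bounding inequality for the excess loss.

The best scale depends on the random number `N ε`. A union bound over dyadic scales costs
a logarithm of the ratio `(N ε + D) / D`, and Markov's inequality for the total expected loss,
whose mean is at most `10 D`, bounds that ratio by a multiple of `1 / δ`. Hence the union bound only
changes `log (1 / δ)` by a constant factor, and the bound holds with `log (1 / δ)` in place of
`C ≥ log (1 / δ)`.
-/

open Filter Topology

/-! ### The dual norm -/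

section Norm

variable {H : Type*} [NormedAddCommGroup H] [InnerProductSpace ℝ H] {p : Seminorm ℝ H}

lemma IsEquivalentNorm.pos_of_ne_zero (hp : IsEquivalentNorm p) {x : H} (hx : x ≠ 0) :
    0 < p x := by
  obtain ⟨c, hc, C, h⟩ := hp
  have := norm_pos_iff.2 hx
  exact lt_of_lt_of_le (by positivity) (h x).1

lemma IsEquivalentNorm.exists_le_mul_norm (hp : IsEquivalentNorm p) :
    ∃ C > (0 : ℝ), ∀ x : H, p x ≤ C * ‖x‖ := by
  obtain ⟨c, hc, C, h⟩ := hp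
  refine ⟨max C 1, by positivity, fun x => (h x).2.trans ?_⟩
  gcongr
  exact le_max_left _ _

lemma IsEquivalentNorm.exists_norm_le_mul (hp : IsEquivalentNorm p) :
    ∃ C > (0 : ℝ), ∀ x : H, ‖x‖ ≤ C * p x := by
  obtain ⟨c, hc, C, h⟩ := hp
  refine ⟨c⁻¹, by positivity, fun x => ?_⟩
  have := (h x).1
  rw [inv_mul_eq_div, le_div_iff₀ hc]
  linarith

lemma IsEquivalentNorm.continuous (hp : IsEquivalentNorm p) : Continuous p := by
  obtain ⟨C, hC, h⟩ := hp.exists_le_mul_norm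
  have : LipschitzWith ⟨C, hC.le⟩ p := LipschitzWith.of_dist_le_mul fun x y => by
    rw [Real.dist_eq, dist_eq_norm]
    exact (abs_sub_map_le_sub p x y).trans (h _)
  exact this.continuous

lemma IsEquivalentNorm.inner_le (hp : IsEquivalentNorm p) (x y : H) :
    inner ℝ x y ≤ dualNorm p x * p y := by
  rcases eq_or_ne y 0 with rfl | hy
  · simp
  have hpy := hp.pos_of_ne_zero hy
  obtain ⟨C, hC, h⟩ := hp.exists_norm_le_mul
  have hbdd : BddAbove ((fun y : H => inner ℝ x y) '' {y : H | p y = 1}) := by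
    refine ⟨‖x‖ * C, ?_⟩
    rintro _ ⟨z, hz, rfl⟩
    have h1 := h z
    rw [hz, mul_one] at h1
    exact (real_inner_le_norm x z).trans (by gcongr)
  have : inner ℝ x ((p y)⁻¹ • y) ≤ dualNorm p x := by
    refine le_csSup hbdd ⟨(p y)⁻¹ • y, ?_, rfl⟩
    simp [map_smul_eq_mul, abs_of_pos hpy, hpy.ne']
  rw [inner_smul_right, inv_mul_eq_div, div_le_iff₀ hpy] at this
  exact this

lemma dualNorm_nonneg (p : Seminorm ℝ H) (x : H) : 0 ≤ dualNorm p x := by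
  unfold dualNorm
  rcases Set.eq_empty_or_nonempty ((fun y : H => inner ℝ x y) '' {y : H | p y = 1}) with h | h
  · rw [h, Real.sSup_empty]
  obtain ⟨_, y, hy, rfl⟩ := h
  -- The supremum is over a symmetric set; if that set is unbounded, the supremum is `0`.
  by_cases hb : BddAbove ((fun y : H => inner ℝ x y) '' {y : H | p y = 1})
  · have h1 := le_csSup hb ⟨y, hy, rfl⟩
    have h2 := le_csSup hb ⟨-y, by simpa using hy, rfl⟩
    simp only [inner_neg_right] at h1 h2
    linarith
  · rw [Real.sSup_of_not_bddAbove hb]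

lemma dualNorm_le {x : H} {M : ℝ} (hM : 0 ≤ M) (h : ∀ y, p y = 1 → inner ℝ x y ≤ M) :
    dualNorm p x ≤ M := by
  apply Real.sSup_le _ hM
  rintro _ ⟨y, hy, rfl⟩
  exact h y hy

lemma IsEquivalentNorm.abs_inner_le (hp : IsEquivalentNorm p) (x y : H) :
    |inner ℝ x y| ≤ dualNorm p x * p y := by
  refine abs_le.2 ⟨?_, hp.inner_le x y⟩
  have := hp.inner_le x (-y)
  rw [inner_neg_right, map_neg_eq_map] at this
  linarith

lemma IsEquivalentNorm.dualNorm_sub_le (hp : IsEquivalentNorm p) (x y : H) :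
    dualNorm p (x - y) ≤ dualNorm p x + dualNorm p y := by
  refine dualNorm_le (add_nonneg (dualNorm_nonneg p x) (dualNorm_nonneg p y)) fun z hz => ?_
  have h1 := hp.inner_le x z
  have h2 := (abs_le.1 (hp.abs_inner_le y z)).1
  rw [inner_sub_left]
  rw [hz] at h1 h2
  linarith

lemma IsEquivalentNorm.dualNorm_smul_le (hp : IsEquivalentNorm p) (c : ℝ) (x : H) :
    dualNorm p (c • x) ≤ |c| * dualNorm p x := by
  refine dualNorm_le (mul_nonneg (abs_nonneg c) (dualNorm_nonneg p x)) fun z hz => ?_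
  have h2 := hp.abs_inner_le x z
  rw [hz, mul_one] at h2
  rw [inner_smul_left]
  refine (le_abs_self _).trans ?_
  rw [abs_mul]
  exact mul_le_mul_of_nonneg_left h2 (abs_nonneg c)

lemma IsEquivalentNorm.exists_norm_le_dualNorm (hp : IsEquivalentNorm p) :
    ∃ C > (0 : ℝ), ∀ x : H, ‖x‖ ≤ C * dualNorm p x := by
  obtain ⟨C, hC, h⟩ := hp.exists_le_mul_norm
  refine ⟨C, hC, fun x => ?_⟩
  rcases eq_or_ne x 0 with rfl | hx
  · simpa using mul_nonneg hC.le (dualNorm_nonneg p 0)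
  have h1 := hp.inner_le x x
  rw [real_inner_self_eq_norm_sq] at h1
  have h2 := mul_le_mul_of_nonneg_left (h x) (dualNorm_nonneg p x)
  have h3 := norm_pos_iff.2 hx
  nlinarith

lemma IsEquivalentNorm.exists_dualNorm_le_norm (hp : IsEquivalentNorm p) :
    ∃ C > (0 : ℝ), ∀ x : H, dualNorm p x ≤ C * ‖x‖ := by
  obtain ⟨C, hC, h⟩ := hp.exists_norm_le_mul
  refine ⟨C, hC, fun x => dualNorm_le (by positivity) fun y hy => ?_⟩
  have h1 := h y
  rw [hy, mul_one] at h1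
  calc inner ℝ x y ≤ ‖x‖ * ‖y‖ := real_inner_le_norm x y
    _ ≤ ‖x‖ * C := by gcongr
    _ = C * ‖x‖ := mul_comm _ _

end Norm

/-! ### Convex, smooth, non-negative functions -/

section Smooth

variable {H : Type*} [NormedAddCommGroup H] [InnerProductSpace ℝ H] [CompleteSpace H]
  {p : Seminorm ℝ H} {β : ℝ} {f : H → ℝ}

lemma ConvexOn.sub_le_inner_gradient (hf : ConvexOn ℝ Set.univ f) (hd : Differentiable ℝ f)
    (x y : H) : f x - f y ≤ inner ℝ (gradient f x) (x - y) := by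
  set g : ℝ → ℝ := fun t => f (AffineMap.lineMap x y t) with hg
  have hgc : ConvexOn ℝ Set.univ g := by
    exact hf.comp_affineMap (AffineMap.lineMap (k := ℝ) x y)
  have hgd : HasDerivAt g (inner ℝ (gradient f x) (y - x)) 0 := by
    have h1 : HasFDerivAt f (InnerProductSpace.toDual ℝ H (gradient f x))
        (AffineMap.lineMap x y (0 : ℝ)) := by
      simpa using (hd x).hasGradientAt.hasFDerivAt
    have h2 : HasDerivAt (fun t : ℝ => AffineMap.lineMap x y t) (y - x) (0 : ℝ) :=
      AffineMap.hasDerivAt_lineMap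
    exact h1.comp_hasDerivAt 0 h2
  have := hgc.le_slope_of_hasDerivAt (Set.mem_univ 0) (Set.mem_univ 1) one_pos hgd
  simp only [slope_def_field, hg, AffineMap.lineMap_apply_one, AffineMap.lineMap_apply_zero,
    sub_zero, div_one] at this
  rw [← neg_sub y x, inner_neg_right]
  linarith

namespace CSN

lemma sub_le_inner (hf : CSN p β f) (x y : H) : f x - f y ≤ inner ℝ (gradient f x) (x - y) :=
  hf.convex.sub_le_inner_gradient hf.differentiable x y

lemma le_quadratic (hp : IsEquivalentNorm p) (hf : CSN p β f) (x y : H) :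
    f y ≤ f x + inner ℝ (gradient f x) (y - x) + β * p (y - x) ^ 2 := by
  have h1 := hf.sub_le_inner y x
  have h2 := hp.inner_le (gradient f y - gradient f x) (y - x)
  have h3 := mul_le_mul_of_nonneg_right (hf.smooth y x) (apply_nonneg p (y - x))
  rw [inner_sub_left] at h2
  nlinarith

/-- Self-bounding property: minimising the quadratic upper bound of a non-negative smooth function
along a ray shows that small values force small gradients. -/
lemma dualNorm_gradient_le (hp : IsEquivalentNorm p) (hβ : 0 < β) (hf : CSN p β f) (x : H) :
    dualNorm p (gradient f x) ≤ √(4 * β * f x) := by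
  refine dualNorm_le (Real.sqrt_nonneg _) fun v hv => Real.le_sqrt_of_sq_le ?_
  set a := inner ℝ (gradient f x) v
  have h1 := hf.le_quadratic hp x (x - (a / (2 * β)) • v)
  have h0 := hf.nonneg (x - (a / (2 * β)) • v)
  rw [sub_sub_cancel_left, inner_neg_right, inner_smul_right, map_neg_eq_map, map_smul_eq_mul, hv,
    mul_one, Real.norm_eq_abs, sq_abs] at h1
  have h2 : f x + -(a / (2 * β) * a) + β * (a / (2 * β)) ^ 2 = f x - a ^ 2 / (4 * β) := by
    field_simp
    ring
  have h3 : a ^ 2 / (4 * β) ≤ f x := by linarith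
  rw [div_le_iff₀ (by positivity)] at h3
  linarith

lemma dualNorm_gradient_sq_le (hp : IsEquivalentNorm p) (hβ : 0 < β) (hf : CSN p β f) (x : H) :
    dualNorm p (gradient f x) ^ 2 ≤ 4 * β * f x := by
  have h := hf.dualNorm_gradient_le hp hβ x
  have h0 := hf.nonneg x
  calc _ ≤ √(4 * β * f x) ^ 2 := by
        gcongr
        exact dualNorm_nonneg p _
    _ = _ := Real.sq_sqrt (by positivity)

lemma abs_inner_gradient_le (hp : IsEquivalentNorm p) (hβ : 0 < β) (hf : CSN p β f) (x v : H) :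
    |inner ℝ (gradient f x) v| ≤ f x + β * p v ^ 2 := by
  refine (hp.abs_inner_le _ v).trans ?_
  have h1 := hf.dualNorm_gradient_sq_le hp hβ x
  set d := dualNorm p (gradient f x)
  have h2 : d * p v ≤ d ^ 2 / (4 * β) + β * p v ^ 2 := by
    have : d ^ 2 / (4 * β) + β * p v ^ 2 - d * p v = (d - 2 * β * p v) ^ 2 / (4 * β) := by
      field_simp
      ring
    have : 0 ≤ (d - 2 * β * p v) ^ 2 / (4 * β) := by positivity
    linarith
  have h3 : d ^ 2 / (4 * β) ≤ f x := by
    rw [div_le_iff₀ (by positivity)]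
    linarith
  linarith

lemma le_two_mul (hp : IsEquivalentNorm p) (hβ : 0 < β) (hf : CSN p β f) (x y : H) :
    f y ≤ 2 * f x + 2 * β * p (y - x) ^ 2 := by
  have h1 := hf.le_quadratic hp x y
  have h2 := (abs_le.1 (hf.abs_inner_gradient_le hp hβ x (y - x))).2
  linarith

lemma continuous_gradient (hp : IsEquivalentNorm p) (hβ : 0 < β) (hf : CSN p β f) :
    Continuous (gradient f) := by
  obtain ⟨C, hC, h⟩ := hp.exists_norm_le_dualNorm
  obtain ⟨C', hC', h'⟩ := hp.exists_le_mul_norm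
  have : LipschitzWith ⟨C * (β * C'), by positivity⟩ (gradient f) :=
    LipschitzWith.of_dist_le_mul fun x y => by
      rw [dist_eq_norm, dist_eq_norm]
      change _ ≤ C * (β * C') * ‖x - y‖
      calc _ ≤ C * dualNorm p (gradient f x - gradient f y) := h _
        _ ≤ C * (β * (C' * ‖x - y‖)) := by
          gcongr
          exact (hf.smooth x y).trans (by gcongr; exact h' _)
        _ = _ := by ring
  exact this.continuous

lemma abs_slope_sub_inner_gradient_le (hp : IsEquivalentNorm p) (hf : CSN p β f) (x v : H) {t : ℝ}
    (ht : 0 < t) :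
    |(f (x + t • v) - f x) / t - inner ℝ (gradient f x) v| ≤ t * (β * p v ^ 2) := by
  have h1 := hf.le_quadratic hp x (x + t • v)
  have h2 := hf.sub_le_inner x (x + t • v)
  rw [add_sub_cancel_left, inner_smul_right, map_smul_eq_mul, Real.norm_eq_abs, mul_pow,
    sq_abs] at h1
  rw [sub_add_cancel_left, inner_neg_right, inner_smul_right] at h2
  have h3 : (f (x + t • v) - f x) / t - inner ℝ (gradient f x) v =
      (f (x + t • v) - f x - t * inner ℝ (gradient f x) v) / t := by
    field_simp
  rw [h3, abs_div, abs_of_pos ht, div_le_iff₀ ht, abs_of_nonneg (by linarith)]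
  linarith

end CSN

end Smooth

/-! ### Follow the regularised leader -/

section FTRL

variable {H : Type*} [NormedAddCommGroup H] [InnerProductSpace ℝ H] [CompleteSpace H]
  {p : Seminorm ℝ H} {Θ : Set H} {R B : ℝ}

/-- Maximisers of `⟪z, ·⟫ - D` over a closed, convex, bounded set exist and depend continuously on
`z` if `D` is strongly convex. Only the midpoint form of strong convexity is used; it yields the
quadratic growth of the last clause with the constant `1 / 4` instead of the optimal `1 / 2`. -/
lemma IsEquivalentNorm.exists_continuous_argmax (hp : IsEquivalentNorm p) (hcl : IsClosed Θ)
    (hconv : Convex ℝ Θ) (hne : Θ.Nonempty) (hR : ∀ x ∈ Θ, p x ≤ R) {D : H → ℝ}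
    (hDc : Continuous D) (hD0 : ∀ x, 0 ≤ D x)
    (hD : ∀ a b, D ((1 / 2 : ℝ) • (a + b)) ≤ (D a + D b) / 2 - p (a - b) ^ 2 / 8) :
    ∃ Φ : H → H, Continuous Φ ∧ (∀ z, Φ z ∈ Θ) ∧ ∀ z, ∀ x ∈ Θ,
      inner ℝ z x - D x + p (x - Φ z) ^ 2 / 4 ≤ inner ℝ z (Φ z) - D (Φ z) := by
  have hmem : ∀ a ∈ Θ, ∀ b ∈ Θ, (1 / 2 : ℝ) • (a + b) ∈ Θ := fun a ha b hb => by
    rw [smul_add]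
    exact hconv ha hb (by norm_num) (by norm_num) (by norm_num)
  obtain ⟨C, hC, hCp⟩ := hp.exists_norm_le_mul
  have key : ∀ z : H, ∃ u ∈ Θ, ∀ x ∈ Θ,
      inner ℝ z x - D x + p (x - u) ^ 2 / 4 ≤ inner ℝ z u - D u := by
    intro z
    set F : H → ℝ := fun x => D x - inner ℝ z x with hF
    have hFc : Continuous F := by fun_prop
    have hFm : ∀ a b, F ((1 / 2 : ℝ) • (a + b)) ≤ (F a + F b) / 2 - p (a - b) ^ 2 / 8 := by
      intro a b
      have := hD a b
      simp only [hF, inner_smul_right, inner_add_right]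
      linarith
    have hbdd : BddBelow (F '' Θ) := by
      refine ⟨-(dualNorm p z * R), ?_⟩
      rintro _ ⟨x, hx, rfl⟩
      have h1 := hp.inner_le z x
      have h2 := mul_le_mul_of_nonneg_left (hR x hx) (dualNorm_nonneg p z)
      have h3 := hD0 x
      simp only [hF]
      linarith
    set I := sInf (F '' Θ) with hI
    have hIle : ∀ x ∈ Θ, I ≤ F x := fun x hx => csInf_le hbdd ⟨x, hx, rfl⟩
    have hex : ∀ n : ℕ, ∃ u ∈ Θ, F u < I + 1 / ((n : ℝ) + 1) := by
      intro n
      obtain ⟨_, ⟨u, hu, rfl⟩, h⟩ := exists_lt_of_csInf_lt (hne.image F)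
        (show sInf (F '' Θ) < I + 1 / ((n : ℝ) + 1) by
          have : 0 < 1 / ((n : ℝ) + 1) := by positivity
          linarith)
      exact ⟨u, hu, h⟩
    choose u hu hul using hex
    have hcau : CauchySeq u := by
      refine cauchySeq_of_le_tendsto_0 (fun n : ℕ => C * √(8 * (1 / ((n : ℝ) + 1))))
        (fun n m k hn hm => ?_) ?_
      · rw [dist_eq_norm]
        refine (hCp _).trans ?_
        gcongr
        refine Real.le_sqrt_of_sq_le ?_
        have h1 := hFm (u n) (u m)
        have h2 := hIle _ (hmem _ (hu n) _ (hu m))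
        have h3 : 1 / ((n : ℝ) + 1) ≤ 1 / ((k : ℝ) + 1) := by gcongr
        have h4 : 1 / ((m : ℝ) + 1) ≤ 1 / ((k : ℝ) + 1) := by gcongr
        have h5 := hul n
        have h6 := hul m
        linarith
      · have h1 : Tendsto (fun n : ℕ => C * √(8 * (1 / ((n : ℝ) + 1)))) atTop
            (𝓝 (C * √(8 * 0))) :=
          ((tendsto_one_div_add_atTop_nhds_zero_nat (𝕜 := ℝ)).const_mul 8).sqrt.const_mul C
        simpa using h1
    obtain ⟨v, hv⟩ := cauchySeq_tendsto_of_complete hcau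
    have hvΘ : v ∈ Θ := hcl.mem_of_tendsto hv (Eventually.of_forall hu)
    have hFv : F v ≤ I := by
      have h1 : Tendsto (fun n => F (u n)) atTop (𝓝 (F v)) := (hFc.tendsto v).comp hv
      have h2 : Tendsto (fun n : ℕ => I + 1 / ((n : ℝ) + 1)) atTop (𝓝 (I + 0)) :=
        (tendsto_one_div_add_atTop_nhds_zero_nat (𝕜 := ℝ)).const_add I
      rw [add_zero] at h2
      exact le_of_tendsto_of_tendsto' h1 h2 fun n => (hul n).le
    refine ⟨v, hvΘ, fun x hx => ?_⟩
    have h1 := hFm x v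
    have h2 := hIle _ (hmem _ hx _ hvΘ)
    simp only [hF] at h1 h2 hFv ⊢
    linarith
  choose Φ hΦ hopt using key
  refine ⟨Φ, ?_, hΦ, hopt⟩
  obtain ⟨C', hC', hCd⟩ := hp.exists_dualNorm_le_norm
  have : LipschitzWith ⟨C * (2 * C'), by positivity⟩ Φ := LipschitzWith.of_dist_le_mul fun x y => by
    rw [dist_eq_norm, dist_eq_norm]
    change _ ≤ C * (2 * C') * ‖x - y‖
    have h1 := hopt x _ (hΦ y)
    have h2 := hopt y _ (hΦ x)
    have h3 := hp.inner_le (x - y) (Φ x - Φ y)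
    have h4 := mul_le_mul_of_nonneg_right (hCd (x - y)) (apply_nonneg p (Φ x - Φ y))
    rw [map_sub_rev p] at h1
    rw [inner_sub_left, inner_sub_right, inner_sub_right] at h3
    have h5 : p (Φ x - Φ y) ^ 2 ≤ 2 * C' * ‖x - y‖ * p (Φ x - Φ y) := by nlinarith
    have h6 : p (Φ x - Φ y) ≤ 2 * C' * ‖x - y‖ := by
      rcases (apply_nonneg p (Φ x - Φ y)).eq_or_lt' with h0 | h0
      · rw [h0]
        positivity
      · nlinarith
    calc _ ≤ C * p (Φ x - Φ y) := hCp _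
      _ ≤ C * (2 * C' * ‖x - y‖) := by gcongr
      _ = _ := by ring
  exact this.continuous

/-- The rescaled Bregman divergence from a point of the sphere of radius `R` is a strongly convex
function whose values on the ball of radius `R` are at most `B ^ 2 * R ^ 2`. The geometric constant
controls the divergence between points of the sphere only; convexity in the first argument extends
the bound to the ball. -/
lemma HasGeometricConstant.exists_regularizer [Nontrivial H] (hp : IsEquivalentNorm p)
    (hB : HasGeometricConstant p B) (hR : 0 < R) :
    ∃ D : H → ℝ, Continuous D ∧ (∀ x, 0 ≤ D x) ∧
      (∀ a b, D ((1 / 2 : ℝ) • (a + b)) ≤ (D a + D b) / 2 - p (a - b) ^ 2 / 8) ∧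
      ∀ x, p x ≤ R → D x ≤ B ^ 2 * R ^ 2 := by
  obtain ⟨h, hd, hs, hu⟩ := hB
  obtain ⟨e, he⟩ : ∃ e : H, p e = 1 := by
    obtain ⟨x, hx⟩ := exists_ne (0 : H)
    have := hp.pos_of_ne_zero hx
    exact ⟨(p x)⁻¹ • x, by simp [map_smul_eq_mul, abs_of_pos this, this.ne']⟩
  have hunit : ∀ x, p x ≤ 1 → bregman h x e ≤ B ^ 2 := by
    intro x hx
    obtain ⟨u, hpu, hxu⟩ : ∃ u, p u = 1 ∧ x = p x • u := by
      rcases eq_or_ne x 0 with rfl | hx0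
      · exact ⟨e, he, by simp⟩
      · have := hp.pos_of_ne_zero hx0
        exact ⟨(p x)⁻¹ • x, by simp [map_smul_eq_mul, abs_of_pos this, this.ne'],
          by rw [smul_smul, mul_inv_cancel₀ this.ne', one_smul]⟩
    have h0 := apply_nonneg p x
    set r := p x with hr
    have h1 := hu u e hpu he
    have h2 := hu (-u) e (by simpa using hpu) he
    have h3 := (mul_nonneg (by norm_num) (sq_nonneg (p (u - x)))).trans (hs u x)
    have h4 := (mul_nonneg (by norm_num) (sq_nonneg (p (-u - x)))).trans (hs (-u) x)
    unfold bregman at h1 h2 h3 h4 ⊢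
    have h5 : u - x = (1 - r) • u := by rw [sub_smul, one_smul, ← hxu]
    have h6 : -u - x = -((1 + r) • u) := by
      rw [add_smul, one_smul, ← hxu]
      abel
    have h7 : x - e = r • u - e := by rw [← hxu]
    rw [h5, inner_smul_right] at h3
    rw [h6, inner_neg_right, inner_smul_right] at h4
    rw [inner_sub_right] at h1 h2
    rw [inner_neg_right] at h2
    rw [h7, inner_sub_right, inner_smul_right]
    -- `x` is the convex combination of `u` and `-u` with weights `(1 + r) / 2` and `(1 - r) / 2`.
    have e1 := mul_nonneg (show 0 ≤ (1 + r) / 2 by linarith) h3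
    have e2 := mul_nonneg (show 0 ≤ (1 - r) / 2 by linarith) h4
    have e3 := mul_le_mul_of_nonneg_left h1 (show 0 ≤ (1 + r) / 2 by linarith)
    have e4 := mul_le_mul_of_nonneg_left h2 (show 0 ≤ (1 - r) / 2 by linarith)
    linarith
  refine ⟨fun x => R ^ 2 * bregman h (R⁻¹ • x) e, ?_, ?_, ?_, ?_⟩
  · have := hd.continuous
    unfold bregman
    fun_prop
  · intro x
    exact mul_nonneg (by positivity) ((by positivity : (0 : ℝ) ≤ _).trans (hs (R⁻¹ • x) e))
  · intro a b
    have hmid : ∀ a b, bregman h ((1 / 2 : ℝ) • (a + b)) e ≤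
        (bregman h a e + bregman h b e) / 2 - p (a - b) ^ 2 / 8 := by
      intro a b
      set m := (1 / 2 : ℝ) • (a + b) with hm
      have h1 := hs a m
      have h2 := hs b m
      have h3 : a - m = (1 / 2 : ℝ) • (a - b) := by rw [hm]; module
      have h4 : b - m = -((1 / 2 : ℝ) • (a - b)) := by rw [hm]; module
      have h5 : m - e = (1 / 2 : ℝ) • ((a - e) + (b - e)) := by rw [hm]; module
      unfold bregman at h1 h2 ⊢
      rw [h3, map_smul_eq_mul, inner_smul_right] at h1
      rw [h4, map_neg_eq_map, map_smul_eq_mul, inner_neg_right, inner_smul_right] at h2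
      rw [h5, inner_smul_right, inner_add_right]
      norm_num at h1 h2 ⊢
      linarith
    have h1 := hmid (R⁻¹ • a) (R⁻¹ • b)
    rw [← smul_sub, map_smul_eq_mul, ← smul_add, smul_comm, Real.norm_eq_abs, mul_pow, sq_abs] at h1
    refine (mul_le_mul_of_nonneg_left h1 (sq_nonneg R)).trans_eq ?_
    field_simp
  · intro x hx
    have := hunit (R⁻¹ • x) (by
      rw [map_smul_eq_mul, Real.norm_eq_abs, abs_of_pos (by positivity), inv_mul_eq_div,
        div_le_one hR]
      exact hx)
    exact (mul_le_mul_of_nonneg_left this (sq_nonneg R)).trans_eq (mul_comm _ _)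

/-- The regret bound of follow-the-regularised-leader on a set of radius `R`, for a decision rule
`Φ` that is continuous, so that measurable losses lead to measurable decisions. -/
lemma HasGeometricConstant.exists_ftrl [Nontrivial H] (hp : IsEquivalentNorm p)
    (hB : HasGeometricConstant p B) (hcl : IsClosed Θ) (hconv : Convex ℝ Θ) (hne : Θ.Nonempty)
    (hR0 : 0 < R) (hR : ∀ x ∈ Θ, p x ≤ R) :
    ∃ Φ : H → H, Continuous Φ ∧ (∀ z, Φ z ∈ Θ) ∧ ∀ (ζ : ℕ → H) (N : ℕ), ∀ x ∈ Θ,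
      ∑ n ∈ Finset.range N, inner ℝ (ζ n) (x - Φ (∑ i ∈ Finset.range n, ζ i)) ≤
        B ^ 2 * R ^ 2 + ∑ n ∈ Finset.range N, dualNorm p (ζ n) ^ 2 := by
  obtain ⟨D, hDc, hD0, hDm, hDB⟩ := hB.exists_regularizer hp hR0
  obtain ⟨Φ, hΦc, hΦ, hopt⟩ := hp.exists_continuous_argmax hcl hconv hne hR hDc hD0 hDm
  refine ⟨Φ, hΦc, hΦ, fun ζ N x hx => ?_⟩
  set z : ℕ → H := fun n => ∑ i ∈ Finset.range n, ζ i with hz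
  have hstep : ∀ n, inner ℝ (z (n + 1)) (Φ (z (n + 1))) - D (Φ (z (n + 1))) ≤
      inner ℝ (z n) (Φ (z n)) - D (Φ (z n)) + inner ℝ (ζ n) (Φ (z n)) + dualNorm p (ζ n) ^ 2 := by
    intro n
    have h1 := hopt (z n) _ (hΦ (z (n + 1)))
    have h2 := hp.inner_le (ζ n) (Φ (z (n + 1)) - Φ (z n))
    have h3 : z (n + 1) = z n + ζ n := Finset.sum_range_succ _ _
    rw [inner_sub_right] at h2
    have h4 : inner ℝ (z (n + 1)) (Φ (z (n + 1))) =
        inner ℝ (z n) (Φ (z (n + 1))) + inner ℝ (ζ n) (Φ (z (n + 1))) := by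
      conv_lhs => rw [h3, inner_add_left, ← h3]
    nlinarith [sq_nonneg (p (Φ (z (n + 1)) - Φ (z n)) / 2 - dualNorm p (ζ n))]
  have hsum : inner ℝ (z N) (Φ (z N)) - D (Φ (z N)) ≤
      ∑ n ∈ Finset.range N, (inner ℝ (ζ n) (Φ (z n)) + dualNorm p (ζ n) ^ 2) := by
    induction N with
    | zero => simpa [hz] using hD0 (Φ 0)
    | succ n ih =>
      rw [Finset.sum_range_succ]
      linarith [hstep n]
  have h1 := hopt (z N) x hx
  have h2 := hDB x (hR x hx)
  have h3 : inner ℝ (z N) x = ∑ n ∈ Finset.range N, inner ℝ (ζ n) x := sum_inner _ _ _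
  have h4 : 0 ≤ p (x - Φ (z N)) ^ 2 / 4 := by positivity
  simp only [inner_sub_right, Finset.sum_sub_distrib]
  rw [Finset.sum_add_distrib] at hsum
  linarith

end FTRL

/-! ### Evaluating random functions at random points -/

section RandomEval

lemma MeasureTheory.SimpleFunc.eval_eq_sum_indicator {H Ω E : Type*} [AddCommMonoid E]
    {m : MeasurableSpace Ω} (φ : SimpleFunc Ω H) (F : Ω → H → E) :
    (fun ω => F ω (φ ω)) = ∑ x ∈ φ.range, (φ ⁻¹' {x}).indicator (fun ω => F ω x) := by
  funext ω
  rw [Finset.sum_apply, Finset.sum_eq_single (φ ω)]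
  · exact (Set.indicator_of_mem (show ω ∈ φ ⁻¹' {φ ω} from rfl) fun ω' => F ω' (φ ω)).symm
  · intro x _ hx
    exact Set.indicator_of_notMem (fun h => hx h.symm) _
  · intro h
    exact absurd (φ.mem_range_self ω) h

variable {H Ω : Type*} [NormedAddCommGroup H] {Θ : Set H}

lemma MeasureTheory.StronglyMeasurable.exists_simpleFunc_tendsto_of_mem [Nonempty Ω]
    {m : MeasurableSpace Ω} {θ : Ω → H} (hθ : StronglyMeasurable[m] θ) (hmem : ∀ ω, θ ω ∈ Θ) :
    ∃ φ : ℕ → SimpleFunc Ω H, (∀ k ω, φ k ω ∈ Θ) ∧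
      ∀ ω, Tendsto (fun k => φ k ω) atTop (𝓝 (θ ω)) := by
  borelize H
  have : TopologicalSpace.SeparableSpace (Set.range θ) := hθ.isSeparable_range.separableSpace
  obtain ⟨ω₀⟩ := ‹Nonempty Ω›
  refine ⟨fun k => SimpleFunc.approxOn θ hθ.measurable (Set.range θ) (θ ω₀) ⟨ω₀, rfl⟩ k,
    fun k ω => ?_, fun ω => ?_⟩
  · obtain ⟨ω', h⟩ := SimpleFunc.approxOn_mem hθ.measurable (s := Set.range θ) ⟨ω₀, rfl⟩ k ω
    exact h ▸ hmem ω'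
  · exact SimpleFunc.tendsto_approxOn _ _ (subset_closure ⟨ω, rfl⟩)

lemma stronglyMeasurable_eval {E : Type*} [NormedAddCommGroup E] {m : MeasurableSpace Ω}
    {F : Ω → H → E} (hF : ∀ x, StronglyMeasurable[m] fun ω => F ω x)
    (hc : ∀ ω, Continuous (F ω)) {θ : Ω → H} (hθ : StronglyMeasurable[m] θ) :
    StronglyMeasurable[m] fun ω => F ω (θ ω) := by
  refine stronglyMeasurable_of_tendsto atTop (f := fun k ω => F ω (hθ.approx k ω)) (fun k => ?_)
    (tendsto_pi_nhds.2 fun ω => ((hc ω).tendsto _).comp (hθ.tendsto_approx ω))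
  rw [(hθ.approx k).eval_eq_sum_indicator]
  exact Finset.stronglyMeasurable_sum _ fun x _ =>
    (hF x).indicator ((hθ.approx k).measurableSet_fiber x)

variable [InnerProductSpace ℝ H] [CompleteSpace H] {p : Seminorm ℝ H} {β R : ℝ}
  {m mΩ : MeasurableSpace Ω} {μ : Measure Ω} [IsFiniteMeasure μ] {f g : Ω → H → ℝ}

/-- Unbiasedness at each fixed point of `Θ` extends to unbiasedness at a random point of `Θ` that is
determined by the information one conditions on. -/
lemma condExp_eval (hp : IsEquivalentNorm p) (hβ : 0 < β) (hm : m ≤ mΩ)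
    (hR : ∀ x ∈ Θ, p x ≤ R) (hf : ∀ ω, CSN p β (f ω)) (hg : ∀ ω, CSN p β (g ω))
    (hfm : ∀ x, StronglyMeasurable[mΩ] fun ω => f ω x)
    (hgm : ∀ x, StronglyMeasurable[m] fun ω => g ω x)
    (hfi : ∀ x ∈ Θ, Integrable (fun ω => f ω x) μ)
    (hfg : ∀ x ∈ Θ, (fun ω => g ω x) =ᵐ[μ] μ[fun ω => f ω x | m])
    {θ : Ω → H} (hθ : StronglyMeasurable[m] θ) (hθΘ : ∀ ω, θ ω ∈ Θ) :
    Integrable (fun ω => f ω (θ ω)) μ ∧ Integrable (fun ω => g ω (θ ω)) μ ∧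
      μ[fun ω => f ω (θ ω) | m] =ᵐ[μ] fun ω => g ω (θ ω) := by
  rcases isEmpty_or_nonempty Ω with hΩ | hΩ
  · rw [Measure.eq_zero_of_isEmpty μ]
    exact ⟨integrable_zero_measure, integrable_zero_measure, by
      rw [ae_zero]
      exact eventually_bot⟩
  obtain ⟨ω₀⟩ := id hΩ
  have hgi : ∀ x ∈ Θ, Integrable (fun ω => g ω x) μ := fun x hx =>
    integrable_condExp.congr (hfg x hx).symm
  set x₀ := θ ω₀
  have hx₀ : x₀ ∈ Θ := hθΘ ω₀
  -- On `Θ` a smooth non-negative function is dominated by its value at one point.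
  have hdom : ∀ F : H → ℝ, CSN p β F → ∀ x ∈ Θ, ‖F x‖ ≤ 2 * F x₀ + 2 * β * (R + R) ^ 2 := by
    intro F hF x hx
    rw [Real.norm_of_nonneg (hF.nonneg x)]
    refine (hF.le_two_mul hp hβ x₀ x).trans ?_
    have h1 : p (x - x₀) ≤ R + R := (map_sub_le_add p x x₀).trans (add_le_add (hR x hx) (hR x₀ hx₀))
    have h2 := apply_nonneg p (x - x₀)
    gcongr
  have hbf : Integrable (fun ω => 2 * f ω x₀ + 2 * β * (R + R) ^ 2) μ :=
    ((hfi x₀ hx₀).const_mul 2).add (integrable_const _)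
  have hbg : Integrable (fun ω => 2 * g ω x₀ + 2 * β * (R + R) ^ 2) μ :=
    ((hgi x₀ hx₀).const_mul 2).add (integrable_const _)
  have hfc : ∀ ω, Continuous (f ω) := fun ω => (hf ω).differentiable.continuous
  have hgc : ∀ ω, Continuous (g ω) := fun ω => (hg ω).differentiable.continuous
  have hfI : ∀ ψ : Ω → H, StronglyMeasurable[m] ψ → (∀ ω, ψ ω ∈ Θ) →
      Integrable (fun ω => f ω (ψ ω)) μ := fun ψ hψ hψΘ =>
    hbf.mono' (stronglyMeasurable_eval hfm hfc (hψ.mono hm)).aestronglyMeasurable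
      (Eventually.of_forall fun ω => hdom _ (hf ω) _ (hψΘ ω))
  have hgS : ∀ ψ : Ω → H, StronglyMeasurable[m] ψ → StronglyMeasurable[m] (fun ω => g ω (ψ ω)) :=
    fun ψ hψ => stronglyMeasurable_eval hgm hgc hψ
  have hgI : ∀ ψ : Ω → H, StronglyMeasurable[m] ψ → (∀ ω, ψ ω ∈ Θ) →
      Integrable (fun ω => g ω (ψ ω)) μ := fun ψ hψ hψΘ =>
    hbg.mono' ((hgS ψ hψ).mono hm).aestronglyMeasurable
      (Eventually.of_forall fun ω => hdom _ (hg ω) _ (hψΘ ω))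
  refine ⟨hfI θ hθ hθΘ, hgI θ hθ hθΘ, ?_⟩
  obtain ⟨φ, hφΘ, hφ⟩ := hθ.exists_simpleFunc_tendsto_of_mem hθΘ
  have hfib : ∀ k x, MeasurableSet[m] (φ k ⁻¹' {x}) := fun k x =>
    @SimpleFunc.measurableSet_fiber _ _ m (φ k) x
  have hsm : ∀ k, StronglyMeasurable[m] (φ k) := fun k => (φ k).stronglyMeasurable
  have hlim : μ[fun ω => f ω (θ ω) | m] =ᵐ[μ] μ[fun ω => g ω (θ ω) | m] := by
    refine tendsto_condExp_unique (fun k ω => f ω (φ k ω)) (fun k ω => g ω (φ k ω)) _ _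
      (fun k => hfI _ (hsm k) (hφΘ k)) (fun k => hgI _ (hsm k) (hφΘ k))
      (Eventually.of_forall fun ω => ((hfc ω).tendsto _).comp (hφ ω))
      (Eventually.of_forall fun ω => ((hgc ω).tendsto _).comp (hφ ω))
      _ hbf _ hbg (fun k => Eventually.of_forall fun ω => hdom _ (hf ω) _ (hφΘ k ω))
      (fun k => Eventually.of_forall fun ω => hdom _ (hg ω) _ (hφΘ k ω)) (fun k => ?_)
    rw [condExp_of_stronglyMeasurable hm (hgS _ (hsm k)) (hgI _ (hsm k) (hφΘ k)),
      (φ k).eval_eq_sum_indicator f, (φ k).eval_eq_sum_indicator g]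
    have hxΘ : ∀ x ∈ @SimpleFunc.range _ _ m (φ k), x ∈ Θ := fun x hx => by
      obtain ⟨ω, rfl⟩ := (@SimpleFunc.mem_range _ _ m _ _).1 hx
      exact hφΘ k ω
    refine (condExp_finsetSum (fun x hx => (hfi x (hxΘ x hx)).indicator
      (hm _ (hfib k x))) m).trans ?_
    refine eventuallyEq_sum fun x hx => ?_
    refine (condExp_indicator (hfi x (hxΘ x hx)) (hfib k x)).trans ?_
    exact (hfg x (hxΘ x hx)).symm.indicator
  exact hlim.trans (by
    rw [condExp_of_stronglyMeasurable hm (hgS θ hθ) (hgI θ hθ hθΘ)])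

/-- The gradient noise is conditionally centred in the directions along `Θ`. In directions that
leave the affine span of `Θ` it need not be, since unbiasedness is only known on `Θ`. -/
lemma condExp_inner_gradient_sub (hp : IsEquivalentNorm p) (hβ : 0 < β) (hm : m ≤ mΩ)
    (hconv : Convex ℝ Θ)
    (hR : ∀ x ∈ Θ, p x ≤ R) (hf : ∀ ω, CSN p β (f ω)) (hg : ∀ ω, CSN p β (g ω))
    (hfm : ∀ x, StronglyMeasurable[mΩ] fun ω => f ω x)
    (hgm : ∀ x, StronglyMeasurable[m] fun ω => g ω x)
    (hfi : ∀ x ∈ Θ, Integrable (fun ω => f ω x) μ)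
    (hfg : ∀ x ∈ Θ, (fun ω => g ω x) =ᵐ[μ] μ[fun ω => f ω x | m])
    (hfgrad : ∀ x, StronglyMeasurable[mΩ] fun ω => gradient (f ω) x)
    (hggrad : ∀ x, StronglyMeasurable[m] fun ω => gradient (g ω) x)
    {θ y : Ω → H} (hθ : StronglyMeasurable[m] θ) (hθΘ : ∀ ω, θ ω ∈ Θ)
    (hy : StronglyMeasurable[m] y) (hyΘ : ∀ ω, y ω ∈ Θ) :
    Integrable (fun ω => inner ℝ (gradient (g ω) (θ ω) - gradient (f ω) (θ ω)) (θ ω - y ω)) μ ∧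
      μ[fun ω => inner ℝ (gradient (g ω) (θ ω) - gradient (f ω) (θ ω)) (θ ω - y ω) | m]
        =ᵐ[μ] 0 := by
  have heval : ∀ ψ : Ω → H, StronglyMeasurable[m] ψ → (∀ ω, ψ ω ∈ Θ) → _ := fun ψ hψ hψΘ =>
    condExp_eval hp hβ hm hR hf hg hfm hgm hfi hfg hψ hψΘ
  obtain ⟨hfθ, hgθ, hfgθ⟩ := heval θ hθ hθΘ
  have hv : StronglyMeasurable[m] (fun ω => y ω - θ ω) := hy.sub hθ
  have hpv : ∀ ω, p (y ω - θ ω) ≤ R + R := fun ω =>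
    (map_sub_le_add p _ _).trans (add_le_add (hR _ (hyΘ ω)) (hR _ (hθΘ ω)))
  have hif : ∀ ω, |inner ℝ (gradient (f ω) (θ ω)) (y ω - θ ω)| ≤ f ω (θ ω) + β * (R + R) ^ 2 :=
    fun ω => ((hf ω).abs_inner_gradient_le hp hβ _ _).trans (by gcongr; exact hpv ω)
  have hig : ∀ ω, |inner ℝ (gradient (g ω) (θ ω)) (y ω - θ ω)| ≤ g ω (θ ω) + β * (R + R) ^ 2 :=
    fun ω => ((hg ω).abs_inner_gradient_le hp hβ _ _).trans (by gcongr; exact hpv ω)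
  have hfint : Integrable (fun ω => inner ℝ (gradient (f ω) (θ ω)) (y ω - θ ω)) μ :=
    (hfθ.add (integrable_const (β * (R + R) ^ 2))).mono'
      ((stronglyMeasurable_eval hfgrad (fun ω => (hf ω).continuous_gradient hp hβ)
        (hθ.mono hm)).inner (hv.mono hm)).aestronglyMeasurable (Eventually.of_forall hif)
  have hgint : Integrable (fun ω => inner ℝ (gradient (g ω) (θ ω)) (y ω - θ ω)) μ :=
    (hgθ.add (integrable_const (β * (R + R) ^ 2))).mono'
      (((stronglyMeasurable_eval hggrad (fun ω => (hg ω).continuous_gradient hp hβ)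
        hθ).inner hv).mono hm).aestronglyMeasurable (Eventually.of_forall hig)
  have heq : (fun ω => inner ℝ (gradient (g ω) (θ ω) - gradient (f ω) (θ ω)) (θ ω - y ω)) =
      (fun ω => inner ℝ (gradient (f ω) (θ ω)) (y ω - θ ω)) -
        (fun ω => inner ℝ (gradient (g ω) (θ ω)) (y ω - θ ω)) := by
    funext ω
    rw [Pi.sub_apply, ← neg_sub (y ω) (θ ω), inner_neg_right, inner_sub_left]
    ring
  rw [heq]
  refine ⟨hfint.sub hgint, (condExp_sub hfint hgint m).trans ?_⟩
  -- The directional derivatives are limits of difference quotients between points of `Θ`.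
  set t : ℕ → ℝ := fun k => 1 / ((k : ℝ) + 1) with ht
  have ht0 : ∀ k, 0 < t k := fun k => by simp only [ht]; positivity
  have ht1 : ∀ k, t k ≤ 1 := fun k => by
    simp only [ht]
    rw [div_le_one (by positivity)]
    have : (0 : ℝ) ≤ k := Nat.cast_nonneg k
    linarith
  have htl : Tendsto t atTop (𝓝 0) := tendsto_one_div_add_atTop_nhds_zero_nat
  set ψ : ℕ → Ω → H := fun k ω => θ ω + t k • (y ω - θ ω) with hψ
  have hψm : ∀ k, StronglyMeasurable[m] (ψ k) := fun k => hθ.add (hv.const_smul (t k))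
  have hψΘ : ∀ k ω, ψ k ω ∈ Θ := fun k ω =>
    hconv.add_smul_sub_mem (hθΘ ω) (hyΘ ω) ⟨(ht0 k).le, ht1 k⟩
  have hslope : ∀ F : H → ℝ, CSN p β F → ∀ k ω,
      |(F (ψ k ω) - F (θ ω)) / t k - inner ℝ (gradient F (θ ω)) (y ω - θ ω)| ≤
        t k * (β * (R + R) ^ 2) := fun F hF k ω =>
    (hF.abs_slope_sub_inner_gradient_le hp _ _ (ht0 k)).trans (by
      have := (ht0 k).le
      gcongr
      exact hpv ω)
  have hlim : ∀ F : H → ℝ, CSN p β F → ∀ ω, Tendsto (fun k => (F (ψ k ω) - F (θ ω)) / t k) atTop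
      (𝓝 (inner ℝ (gradient F (θ ω)) (y ω - θ ω))) := fun F hF ω => by
    rw [tendsto_iff_dist_tendsto_zero]
    refine squeeze_zero (fun _ => dist_nonneg) (fun k => hslope F hF k ω) ?_
    simpa using htl.mul_const (β * (R + R) ^ 2)
  have hbound : ∀ F : H → ℝ, CSN p β F → ∀ ω,
      |inner ℝ (gradient F (θ ω)) (y ω - θ ω)| ≤ F (θ ω) + β * (R + R) ^ 2 → ∀ k,
      ‖(F (ψ k ω) - F (θ ω)) / t k‖ ≤ F (θ ω) + 2 * (β * (R + R) ^ 2) := by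
    intro F hF ω h k
    have h1 := hslope F hF k ω
    have h2 : t k * (β * (R + R) ^ 2) ≤ 1 * (β * (R + R) ^ 2) := by
      gcongr
      exact ht1 k
    rw [Real.norm_eq_abs]
    have h3 := abs_add_le ((F (ψ k ω) - F (θ ω)) / t k - inner ℝ (gradient F (θ ω)) (y ω - θ ω))
      (inner ℝ (gradient F (θ ω)) (y ω - θ ω))
    rw [sub_add_cancel] at h3
    linarith
  have hfQ : ∀ k, Integrable (fun ω => (f ω (ψ k ω) - f ω (θ ω)) / t k) μ := fun k =>
    ((heval _ (hψm k) (hψΘ k)).1.sub hfθ).div_const _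
  have hgQ : ∀ k, Integrable (fun ω => (g ω (ψ k ω) - g ω (θ ω)) / t k) μ := fun k =>
    ((heval _ (hψm k) (hψΘ k)).2.1.sub hgθ).div_const _
  have hcond : μ[fun ω => inner ℝ (gradient (f ω) (θ ω)) (y ω - θ ω) | m] =ᵐ[μ]
      μ[fun ω => inner ℝ (gradient (g ω) (θ ω)) (y ω - θ ω) | m] := by
    refine tendsto_condExp_unique (fun k ω => (f ω (ψ k ω) - f ω (θ ω)) / t k)
      (fun k ω => (g ω (ψ k ω) - g ω (θ ω)) / t k) _ _ hfQ hgQ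
      (Eventually.of_forall fun ω => hlim _ (hf ω) ω)
      (Eventually.of_forall fun ω => hlim _ (hg ω) ω)
      (fun ω => f ω (θ ω) + 2 * (β * (R + R) ^ 2)) (hfθ.add (integrable_const _))
      (fun ω => g ω (θ ω) + 2 * (β * (R + R) ^ 2)) (hgθ.add (integrable_const _))
      (fun k => Eventually.of_forall fun ω => hbound _ (hf ω) ω (hif ω) k)
      (fun k => Eventually.of_forall fun ω => hbound _ (hg ω) ω (hig ω) k) (fun k => ?_)
    obtain ⟨h1, h2, h3⟩ := heval _ (hψm k) (hψΘ k)
    have e : ∀ F : Ω → H → ℝ, (fun ω => (F ω (ψ k ω) - F ω (θ ω)) / t k) =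
        (t k)⁻¹ • ((fun ω => F ω (ψ k ω)) - fun ω => F ω (θ ω)) := fun F => by
      funext ω
      simp only [Pi.smul_apply, Pi.sub_apply, smul_eq_mul]
      ring
    rw [condExp_of_stronglyMeasurable hm _ (hgQ k)]
    · rw [e f, e g]
      refine (condExp_smul _ _ _).trans ((EventuallyEq.const_smul ?_ _))
      exact (condExp_sub h1 hfθ m).trans (h3.sub hfgθ)
    · have hgc : ∀ ω, Continuous (g ω) := fun ω => (hg ω).differentiable.continuous
      rw [e g]
      exact ((stronglyMeasurable_eval hgm hgc (hψm k)).sub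
        (stronglyMeasurable_eval hgm hgc hθ)).const_smul _
  filter_upwards [hcond] with ω hω
  rw [Pi.sub_apply, hω, sub_self, Pi.zero_apply]

end RandomEval

/-! ### A self-normalised exponential inequality -/

section Exponential

lemma Real.exp_sub_sq_le (x : ℝ) : Real.exp (x - x ^ 2) ≤ 1 + x + x ^ 2 := by
  have h1 : 0 < 1 - x + x ^ 2 := by nlinarith [sq_nonneg (x - 1 / 2)]
  have h2 : 0 < 1 + x + x ^ 2 := by nlinarith [sq_nonneg (x + 1 / 2)]
  have h3 := Real.add_one_le_exp (-(x - x ^ 2))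
  have h4 : Real.exp (x - x ^ 2) * Real.exp (-(x - x ^ 2)) = 1 := by
    rw [← Real.exp_add, add_neg_cancel, Real.exp_zero]
  have h5 : 1 ≤ (1 + x + x ^ 2) * (1 - x + x ^ 2) := by nlinarith [sq_nonneg x, sq_nonneg (x ^ 2)]
  have h6 := Real.exp_pos (x - x ^ 2)
  have h7 : Real.exp (x - x ^ 2) * (1 - x + x ^ 2) ≤ 1 := by nlinarith
  nlinarith

variable {Ω : Type*} {mΩ : MeasurableSpace Ω} {μ : Measure Ω} [IsProbabilityMeasure μ]

lemma integral_mul_eq_of_condExp_eq {m : MeasurableSpace Ω} (hm : m ≤ mΩ) {f g W : Ω → ℝ}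
    (hf : Integrable f μ) (hfg : μ[f | m] =ᵐ[μ] g) (hW : StronglyMeasurable[m] W) (c : ℝ)
    (hc : ∀ ω, ‖W ω‖ ≤ c) : ∫ ω, W ω * f ω ∂μ = ∫ ω, W ω * g ω ∂μ := by
  have h1 := condExp_stronglyMeasurable_mul_of_bound (μ := μ) hm hW hf c (Eventually.of_forall hc)
  rw [← integral_condExp hm (f := fun ω => W ω * f ω)]
  refine integral_congr_ae (h1.trans ?_)
  filter_upwards [hfg] with ω hω
  simp [hω]

/-- Exponential inequality for martingale differences `X` whose squares are controlled by a
non-negative process `V` and its predictable compensator `L`. No boundedness of `X` is required,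
because `exp (x - x ^ 2) ≤ 1 + x + x ^ 2` holds on the whole line. -/
lemma integral_exp_sum_le_one (ℱ : Filtration ℕ mΩ) {N : ℕ} {X V L : ℕ → Ω → ℝ} {q : ℝ} (hq : 0 ≤ q)
    (hX : ∀ n < N, StronglyMeasurable[ℱ (n + 1)] (X n))
    (hV : ∀ n < N, StronglyMeasurable[ℱ (n + 1)] (V n))
    (hL : ∀ n < N, StronglyMeasurable[ℱ n] (L n))
    (hXi : ∀ n < N, Integrable (X n) μ) (hVi : ∀ n < N, Integrable (V n) μ)
    (hLi : ∀ n < N, Integrable (L n) μ)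
    (hL0 : ∀ n < N, ∀ ω, 0 ≤ L n ω)
    (hXq : ∀ n < N, ∀ ω, X n ω ^ 2 ≤ q * (L n ω + V n ω))
    (hXc : ∀ n < N, μ[X n | ℱ n] =ᵐ[μ] 0) (hVc : ∀ n < N, μ[V n | ℱ n] =ᵐ[μ] L n) (l : ℝ) :
    Integrable (fun ω => Real.exp (∑ n ∈ Finset.range N,
      (l * X n ω - l ^ 2 * q * (V n ω + 3 * L n ω)))) μ ∧
    ∫ ω, Real.exp (∑ n ∈ Finset.range N,
      (l * X n ω - l ^ 2 * q * (V n ω + 3 * L n ω))) ∂μ ≤ 1 := by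
  set Y : ℕ → Ω → ℝ := fun n ω => l * X n ω - l ^ 2 * q * (V n ω + 3 * L n ω) with hY
  set Z : ℕ → Ω → ℝ := fun k ω => Real.exp (∑ n ∈ Finset.range k, Y n ω) with hZ
  have hlq : 0 ≤ l ^ 2 * q := by positivity
  have hYle : ∀ n < N, ∀ ω, Y n ω ≤ (l * X n ω - (l * X n ω) ^ 2) - 2 * (l ^ 2 * q) * L n ω := by
    intro n hn ω
    have h1 := mul_le_mul_of_nonneg_left (hXq n hn ω) (sq_nonneg l)
    simp only [hY]
    nlinarith
  have hY4 : ∀ n < N, ∀ ω, Y n ω ≤ 1 / 4 := by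
    intro n hn ω
    have h1 := hYle n hn ω
    have h2 := mul_nonneg hlq (hL0 n hn ω)
    nlinarith [sq_nonneg (l * X n ω - 1 / 2)]
  have hYm : ∀ n < N, StronglyMeasurable[ℱ (n + 1)] (Y n) := fun n hn =>
    ((hX n hn).const_mul l).sub (((hV n hn).add
      (((hL n hn).mono (ℱ.mono n.le_succ)).const_mul 3)).const_mul (l ^ 2 * q))
  have hZm : ∀ k ≤ N, StronglyMeasurable[ℱ k] (Z k) := fun k hk =>
    Real.continuous_exp.comp_stronglyMeasurable
      (Finset.stronglyMeasurable_fun_sum _ fun n hn => by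
        have hnk := Finset.mem_range.1 hn
        exact (hYm n (by omega)).mono (ℱ.mono hnk))
  have hZb : ∀ k ≤ N, ∀ ω, ‖Z k ω‖ ≤ Real.exp (k * (1 / 4)) := by
    intro k hk ω
    rw [Real.norm_of_nonneg (Real.exp_pos _).le]
    refine Real.exp_le_exp.2 ((Finset.sum_le_card_nsmul _ _ (1 / 4) fun n hn =>
      hY4 n (lt_of_lt_of_le (Finset.mem_range.1 hn) hk) ω).trans_eq ?_)
    rw [Finset.card_range, nsmul_eq_mul]
  have hZi : ∀ k ≤ N, Integrable (Z k) μ := fun k hk =>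
    (integrable_const (Real.exp (k * (1 / 4)))).mono' ((hZm k hk).mono (ℱ.le k)).aestronglyMeasurable
      (Eventually.of_forall (hZb k hk))
  have hstep : ∀ k ≤ N, ∫ ω, Z k ω ∂μ ≤ 1 := by
    intro k
    induction k with
    | zero => intro _; simp [hZ]
    | succ k ih =>
      intro hk
      have hkN : k < N := hk
      refine le_trans ?_ (ih hkN.le)
      set W : Ω → ℝ := fun ω => Z k ω * Real.exp (-(2 * (l ^ 2 * q) * L k ω)) with hW
      have hWm : StronglyMeasurable[ℱ k] W := (hZm k hkN.le).mul
        (Real.continuous_exp.comp_stronglyMeasurable ((hL k hkN).const_mul _).neg)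
      have hW0 : ∀ ω, 0 ≤ W ω := fun ω => mul_nonneg (Real.exp_pos _).le (Real.exp_pos _).le
      have hWZ : ∀ ω, W ω * (1 + 2 * (l ^ 2 * q) * L k ω) ≤ Z k ω := by
        intro ω
        have h1 := Real.add_one_le_exp (2 * (l ^ 2 * q) * L k ω)
        calc W ω * (1 + 2 * (l ^ 2 * q) * L k ω)
            ≤ W ω * Real.exp (2 * (l ^ 2 * q) * L k ω) :=
              mul_le_mul_of_nonneg_left (by linarith) (hW0 ω)
          _ = Z k ω := by
              rw [hW, mul_assoc, ← Real.exp_add, neg_add_cancel, Real.exp_zero, mul_one]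
      have hWb : ∀ ω, ‖W ω‖ ≤ Real.exp (k * (1 / 4)) := by
        intro ω
        refine le_trans ?_ (hZb k hkN.le ω)
        rw [Real.norm_of_nonneg (hW0 ω), Real.norm_of_nonneg (Real.exp_pos _).le]
        have h2 := mul_nonneg hlq (hL0 k hkN ω)
        have h3 := mul_nonneg (hW0 ω) h2
        have h4 := hWZ ω
        nlinarith
      have hWs : AEStronglyMeasurable W μ := (hWm.mono (ℱ.le k)).aestronglyMeasurable
      have hmulW : ∀ f : Ω → ℝ, Integrable f μ → Integrable (fun ω => W ω * f ω) μ := fun f hf =>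
        hf.bdd_mul hWs (Eventually.of_forall hWb)
      have hWi : Integrable W μ := (integrable_const _).mono' hWs (Eventually.of_forall hWb)
      have eX := integral_mul_eq_of_condExp_eq (ℱ.le k) (hXi k hkN) (hXc k hkN) hWm _ hWb
      have eV := integral_mul_eq_of_condExp_eq (ℱ.le k) (hVi k hkN) (hVc k hkN) hWm _ hWb
      simp only [Pi.zero_apply, mul_zero, integral_zero] at eX
      have hpt : ∀ ω, Z (k + 1) ω ≤
          W ω + l * (W ω * X k ω) + l ^ 2 * q * (W ω * L k ω) + l ^ 2 * q * (W ω * V k ω) := by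
        intro ω
        have h1 := Real.exp_sub_sq_le (l * X k ω)
        have h2 := mul_le_mul_of_nonneg_left (hXq k hkN ω) (sq_nonneg l)
        have h3 : Z (k + 1) ω = Z k ω * Real.exp (Y k ω) := by
          simp only [hZ]
          rw [Finset.sum_range_succ, Real.exp_add]
        calc Z (k + 1) ω ≤ Z k ω * Real.exp ((l * X k ω - (l * X k ω) ^ 2)
                - 2 * (l ^ 2 * q) * L k ω) := by
              rw [h3]
              exact mul_le_mul_of_nonneg_left (Real.exp_le_exp.2 (hYle k hkN ω)) (Real.exp_pos _).le
          _ = W ω * Real.exp (l * X k ω - (l * X k ω) ^ 2) := by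
              rw [hW, sub_eq_add_neg _ (2 * (l ^ 2 * q) * L k ω), Real.exp_add]
              ring
          _ ≤ W ω * (1 + l * X k ω + l ^ 2 * (q * (L k ω + V k ω))) :=
              mul_le_mul_of_nonneg_left (by nlinarith) (hW0 ω)
          _ = _ := by ring
      have i1 := (hmulW _ (hXi k hkN)).const_mul l
      have i2 := (hmulW _ (hLi k hkN)).const_mul (l ^ 2 * q)
      have i3 := (hmulW _ (hVi k hkN)).const_mul (l ^ 2 * q)
      have j1 : Integrable (fun ω => W ω + l * (W ω * X k ω)) μ := hWi.add i1
      have j2 : Integrable (fun ω => W ω + l * (W ω * X k ω) + l ^ 2 * q * (W ω * L k ω)) μ :=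
        j1.add i2
      have j3 : Integrable (fun ω => W ω + l ^ 2 * q * (W ω * L k ω)) μ := hWi.add i2
      calc ∫ ω, Z (k + 1) ω ∂μ ≤ ∫ ω, (W ω + l * (W ω * X k ω) + l ^ 2 * q * (W ω * L k ω)
              + l ^ 2 * q * (W ω * V k ω)) ∂μ :=
            integral_mono (hZi _ hk) (j2.add i3) hpt
        _ = ∫ ω, (W ω + l ^ 2 * q * (W ω * L k ω) + l ^ 2 * q * (W ω * L k ω)) ∂μ := by
            rw [integral_add j2 i3, integral_add j1 i2,
              integral_add hWi i1, integral_add j3 i2, integral_add hWi i2,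
              integral_const_mul, integral_const_mul, integral_const_mul, eX, eV]
            ring
        _ ≤ ∫ ω, Z k ω ∂μ :=
            integral_mono (j3.add i2) (hZi k hkN.le) fun ω => by
              have := hWZ ω
              simp only
              linarith
  exact ⟨hZi N le_rfl, hstep N le_rfl⟩

/-- Markov's inequality in the form `μ(Z ≥ E / δ) ≤ δ`. -/
lemma measure_le_ofReal_of_integral_le {Z : Ω → ℝ} (hZ : Integrable Z μ) (hZ0 : ∀ ω, 0 ≤ Z ω)
    {E δ : ℝ} (hE : 0 < E) (hδ : 0 < δ) (h : ∫ ω, Z ω ∂μ ≤ E) :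
    μ {ω | E / δ ≤ Z ω} ≤ ENNReal.ofReal δ := by
  have h1 := mul_meas_ge_le_integral_of_nonneg (μ := μ) (Eventually.of_forall hZ0) hZ (E / δ)
  rw [← ofReal_measureReal]
  refine ENNReal.ofReal_le_ofReal ?_
  rw [div_mul_eq_mul_div, div_le_iff₀ hδ] at h1
  nlinarith

end Exponential

/-! ### Deterministic regret of admissible algorithms -/

section Regret

variable {H : Type*} {Θ : Set H} {N : ℕ} {f : ℕ → H → ℝ}

lemma minTotalLoss_nonneg (hf : ∀ n < N, ∀ x, 0 ≤ f n x) : 0 ≤ minTotalLoss Θ N f := by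
  refine Real.sInf_nonneg ?_
  rintro _ ⟨y, _, rfl⟩
  exact Finset.sum_nonneg fun n hn => hf n (Finset.mem_range.1 hn) y

lemma le_minTotalLoss (hne : Θ.Nonempty) {a : ℝ}
    (h : ∀ x ∈ Θ, a ≤ ∑ n ∈ Finset.range N, f n x) : a ≤ minTotalLoss Θ N f := by
  refine le_csInf (hne.image _) ?_
  rintro _ ⟨y, hy, rfl⟩
  exact h y hy

lemma bias_nonneg (hf : ∀ n < N, ∀ x, 0 ≤ f n x) : 0 ≤ bias Θ N f :=
  mul_nonneg (by positivity) (minTotalLoss_nonneg hf)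

lemma minTotalLoss_congr {g : ℕ → H → ℝ} (h : ∀ n < N, f n = g n) :
    minTotalLoss Θ N f = minTotalLoss Θ N g := by
  unfold minTotalLoss
  congr 2
  funext x
  exact Finset.sum_congr rfl fun n hn => by rw [h n (Finset.mem_range.1 hn)]

lemma OnlineAlgorithm.decision_congr (A : OnlineAlgorithm H) (η : ℝ) {g : ℕ → H → ℝ} {n : ℕ}
    (h : ∀ i < n, f i = g i) : A.decision η f n = A.decision η g n := by
  unfold OnlineAlgorithm.decision
  congr 1
  exact List.map_congr_left fun i hi => h i (List.mem_range.1 hi)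

variable [NormedAddCommGroup H] [InnerProductSpace ℝ H] {p : Seminorm ℝ H}
  {A : OnlineAlgorithm H} {RA RΘ β η : ℝ}

lemma sum_inner_sub_le_regret (hp : IsEquivalentNorm p) (hR : ∀ x ∈ Θ, p x ≤ RΘ) (v θ : ℕ → H)
    {x : H} (hx : x ∈ Θ) :
    ∑ n ∈ Finset.range N, inner ℝ (v n) (θ n - x) ≤ regret Θ N (fun n x => inner ℝ (v n) x) θ := by
  simp only [regret, inner_sub_right, Finset.sum_sub_distrib]
  suffices h : minTotalLoss Θ N (fun n x => inner ℝ (v n) x) ≤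
      ∑ n ∈ Finset.range N, inner ℝ (v n) x from sub_le_sub_left h _
  refine csInf_le ?_ ⟨x, hx, rfl⟩
  refine ⟨-(dualNorm p (∑ n ∈ Finset.range N, v n) * RΘ), ?_⟩
  rintro _ ⟨y, hy, rfl⟩
  simp only
  rw [← sum_inner]
  have h1 := (abs_le.1 (hp.abs_inner_le (∑ n ∈ Finset.range N, v n) y)).1
  have h2 := mul_le_mul_of_nonneg_left (hR y hy) (dualNorm_nonneg p (∑ n ∈ Finset.range N, v n))
  linarith

variable [CompleteSpace H]

lemma gradient_inner_left (v x : H) : gradient (fun y : H => inner ℝ v y) x = v := by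
  have h : HasGradientAt (fun y : H => (inner ℝ v y : ℝ)) v x :=
    (InnerProductSpace.toDual ℝ H v).hasFDerivAt
  exact h.gradient

/-- Without the term `RA ^ 2 / η` the first decision would have to minimise every linear function
over `Θ`, as one sees by scaling the losses down. -/
lemma IsAdmissible.subsingleton (hp : IsEquivalentNorm p) (hR : ∀ x ∈ Θ, p x ≤ RΘ)
    (hA : IsAdmissible p Θ A 0) : Θ.Subsingleton := by
  suffices h : ∀ x ∈ Θ, x = A 1 [] from fun x hx y hy => (h x hx).trans (h y hy).symm
  intro x hx
  set v := A 1 [] - x with hv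
  set d := dualNorm p v
  set t := ‖v‖ ^ 2 / (d ^ 2 + 1) with ht
  have ht0 : 0 ≤ t := by positivity
  set f : ℕ → H → ℝ := fun _ y => inner ℝ (t • v) y with hf
  have hfc : ∀ n, ConvexOn ℝ Set.univ (f n) ∧ Differentiable ℝ (f n) := fun n =>
    ⟨(InnerProductSpace.toDual ℝ H (t • v)).toLinearMap.convexOn convex_univ,
      (InnerProductSpace.toDual ℝ H (t • v)).differentiable⟩
  have h1 := (hA.regret_le 1 one_pos f hfc 1).2
  have h2 := sum_inner_sub_le_regret (N := 1) hp hR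
    (fun n => gradient (f n) (A.decision 1 f n)) (A.decision 1 f) hx
  have h3 := h2.trans h1
  simp only [hf, gradient_inner_left, Finset.sum_range_one] at h3
  have h4 : A.decision 1 (fun _ y => inner ℝ (t • v) y) 0 = A 1 [] := rfl
  rw [h4, ← hv, inner_smul_left, real_inner_self_eq_norm_sq] at h3
  have h5 := hp.dualNorm_smul_le t v
  rw [abs_of_nonneg ht0] at h5
  have h6 : dualNorm p (t • v) ^ 2 ≤ (t * d) ^ 2 := by
    gcongr
    exact dualNorm_nonneg p _
  have h7 : t * (d ^ 2 + 1) = ‖v‖ ^ 2 := by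
    rw [ht]
    field_simp
  simp only [conj_trivial] at h3
  have h8 : t * (t * (d ^ 2 + 1)) ≤ t * (t * d ^ 2) / 2 := by
    rw [h7]
    nlinarith
  have h9 : t = 0 := by
    have h10 : 0 ≤ t * (t * d ^ 2) := by positivity
    have h11 : t ^ 2 ≤ 0 := by nlinarith
    nlinarith
  have h10 : ‖v‖ ^ 2 = 0 := by rw [← h7, h9, zero_mul]
  have h11 : v = 0 := norm_eq_zero.1 (pow_eq_zero_iff two_ne_zero |>.1 h10)
  exact (sub_eq_zero.1 h11).symm

/-- Both regrets are bounded in terms of the incurred losses, since the gradients of smooth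
non-negative losses are self-bounding. -/
lemma IsAdmissible.regret_le_of_csn (hp : IsEquivalentNorm p) (hβ : 0 < β)
    (hR : ∀ x ∈ Θ, p x ≤ RΘ) (hA : IsAdmissible p Θ A RA) (hη : 0 < η)
    (hf : ∀ n < N, CSN p β (f n)) :
    ∑ n ∈ Finset.range N, f n (A.decision η f n) - minTotalLoss Θ N f ≤
        1 / η * RA ^ 2 + 2 * η * β * ∑ n ∈ Finset.range N, f n (A.decision η f n) ∧
      ∀ x ∈ Θ, ∑ n ∈ Finset.range N,
          inner ℝ (gradient (f n) (A.decision η f n)) (A.decision η f n - x) ≤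
        1 / η * RA ^ 2 + 2 * η * β * ∑ n ∈ Finset.range N, f n (A.decision η f n) := by
  classical
  -- Only the first `N` losses are known to be convex, so the others are replaced by zero.
  set f' : ℕ → H → ℝ := fun n => if n < N then f n else 0 with hf'
  have hff : ∀ n < N, f' n = f n := fun n hn => if_pos hn
  have hdec : ∀ n < N, A.decision η f' n = A.decision η f n := fun n hn =>
    A.decision_congr η fun i hi => hff i (hi.trans hn)
  have hcd : ∀ n, ConvexOn ℝ Set.univ (f' n) ∧ Differentiable ℝ (f' n) := by
    intro n
    by_cases hn : n < N
    · rw [hff n hn]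
      exact ⟨(hf n hn).convex, (hf n hn).differentiable⟩
    · rw [hf']
      simp only [if_neg hn]
      exact ⟨convexOn_const (0 : ℝ) convex_univ, differentiable_const (0 : ℝ)⟩
  obtain ⟨h1, h2⟩ := hA.regret_le η hη f' hcd N
  have h3 : regret Θ N f' (A.decision η f') =
      ∑ n ∈ Finset.range N, f n (A.decision η f n) - minTotalLoss Θ N f := by
    unfold regret
    rw [minTotalLoss_congr hff]
    congr 1
    refine Finset.sum_congr rfl fun n hn => ?_
    rw [hff n (Finset.mem_range.1 hn), hdec n (Finset.mem_range.1 hn)]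
  have h4 : ∑ n ∈ Finset.range N, dualNorm p (gradient (f' n) (A.decision η f' n)) ^ 2 ≤
      4 * β * ∑ n ∈ Finset.range N, f n (A.decision η f n) := by
    rw [Finset.mul_sum]
    refine Finset.sum_le_sum fun n hn => ?_
    rw [hff n (Finset.mem_range.1 hn), hdec n (Finset.mem_range.1 hn)]
    exact (hf n (Finset.mem_range.1 hn)).dualNorm_gradient_sq_le hp hβ _
  have h5 := mul_le_mul_of_nonneg_left h4 (half_pos hη).le
  refine ⟨by rw [← h3]; linarith, fun x hx => ?_⟩
  have h6 := sum_inner_sub_le_regret (N := N) hp hR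
    (fun n => gradient (f' n) (A.decision η f' n)) (A.decision η f') hx
  have h7 : ∑ n ∈ Finset.range N, inner ℝ (gradient (f' n) (A.decision η f' n))
        (A.decision η f' n - x) =
      ∑ n ∈ Finset.range N, inner ℝ (gradient (f n) (A.decision η f n))
        (A.decision η f n - x) := by
    refine Finset.sum_congr rfl fun n hn => ?_
    rw [hff n (Finset.mem_range.1 hn), hdec n (Finset.mem_range.1 hn)]
  rw [← h7]
  linarith

lemma stepsize_pos (hβ : 0 < β) (E : ℝ) : 0 < stepsize β N E RA := by
  unfold stepsize
  positivity

/-- With the tuned stepsize, the total loss is of order `D` and the linearised regret is of order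
`√(β R ^ 2 D)`, for any `D ≥ N * E + β * R ^ 2`. -/
lemma IsAdmissible.regret_stepsize_le (hp : IsEquivalentNorm p) (hβ : 0 < β)
    (hR : ∀ x ∈ Θ, p x ≤ RΘ) (hA : IsAdmissible p Θ A RA) (hRA : 0 < RA) {R E D : ℝ}
    (hRAR : RA ≤ R) (hE : 0 ≤ E) (hf : ∀ n < N, CSN p β (f n))
    (hmin : minTotalLoss Θ N f ≤ N * E) (hD : N * E + β * R ^ 2 ≤ D) :
    ∑ n ∈ Finset.range N, f n (A.decision (stepsize β N E RA) f n) ≤ 10 * D ∧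
      ∀ x ∈ Θ, ∑ n ∈ Finset.range N,
          inner ℝ (gradient (f n) (A.decision (stepsize β N E RA) f n))
            (A.decision (stepsize β N E RA) f n - x) ≤ 12 * √(β * R ^ 2 * D) := by
  have hηpos : 0 < stepsize β N E RA := stepsize_pos hβ E
  obtain ⟨h1, h2⟩ := hA.regret_le_of_csn hp hβ hR hηpos hf
  set S := ∑ n ∈ Finset.range N, f n (A.decision (stepsize β N E RA) f n) with hS
  set η := stepsize β N E RA with hη
  set s := √(β ^ 2 + (1 / 2) * β * N * E * (RA ^ 2)⁻¹) with hs
  have hs0 : 0 ≤ s := Real.sqrt_nonneg _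
  have hNE : 0 ≤ N * E := by positivity
  have hηs : η = 1 / (2 * (β + s)) := rfl
  have hinv : 1 / η = 2 * (β + s) := by rw [hηs, one_div_one_div]
  have hss : s ^ 2 * RA ^ 2 = β ^ 2 * RA ^ 2 + β * (N * E) / 2 := by
    rw [hs, Real.sq_sqrt (by positivity)]
    field_simp
  have hηm : η * (2 * (β + s)) = 1 := by
    rw [hηs]
    field_simp
  have hβs : β ≤ s := Real.le_sqrt_of_sq_le (by
    have : 0 ≤ 1 / 2 * β * N * E * (RA ^ 2)⁻¹ := by positivity
    linarith)
  have hηβ : 4 * (η * β) ≤ 1 := by nlinarith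
  rw [hinv] at h1 h2
  have hS0 : 0 ≤ S := Finset.sum_nonneg fun n hn => (hf n (Finset.mem_range.1 hn)).nonneg _
  set r := 2 * (β + s) * RA ^ 2 with hr
  have hr0 : 0 ≤ r := by positivity
  have hSle : S ≤ 2 * (N * E + r) := by nlinarith
  have hηr : η * r = RA ^ 2 := by
    rw [hr]
    linear_combination RA ^ 2 * hηm
  -- `s` balances the two terms of the regret bound: `η β N E ≤ 2 η s² RA² ≤ s RA²`.
  have hηE : η * β * (N * E) ≤ s * RA ^ 2 := by
    have e1 : β * (N * E) ≤ 2 * (s ^ 2 * RA ^ 2) := by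
      rw [hss]
      have : 0 ≤ β ^ 2 * RA ^ 2 := by positivity
      linarith
    have e2 : η * (2 * s) ≤ 1 := by nlinarith
    calc η * β * (N * E) = η * (β * (N * E)) := by ring
      _ ≤ η * (2 * (s ^ 2 * RA ^ 2)) := by gcongr
      _ = η * (2 * s) * (s * RA ^ 2) := by ring
      _ ≤ 1 * (s * RA ^ 2) := by gcongr
      _ = _ := one_mul _
  have hlin : r + 2 * η * β * S ≤ 3 * r := by
    have e1 : 2 * η * β * S ≤ 2 * η * β * (2 * (N * E + r)) := by gcongr
    have e2 : 2 * η * β * (2 * (N * E + r)) = 4 * (η * β * (N * E)) + 4 * β * (η * r) := by ring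
    rw [e2, hηr] at e1
    nlinarith
  have hR2 : RA ^ 2 ≤ R ^ 2 := by gcongr
  have hR2p : 0 < R ^ 2 := lt_of_lt_of_le (by positivity) hR2
  have hDpos : β * R ^ 2 ≤ D := by linarith
  have hbD : 0 < β * R ^ 2 := by positivity
  have hD0 : 0 < D := lt_of_lt_of_le hbD hDpos
  have hβR : β * RA ^ 2 ≤ √(β * R ^ 2 * D) := by
    refine Real.le_sqrt_of_sq_le ?_
    have e1 : β * RA ^ 2 ≤ β * R ^ 2 := by gcongr
    have e2 : 0 ≤ β * RA ^ 2 := by positivity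
    nlinarith
  have hsR : s * RA ^ 2 ≤ √(β * R ^ 2 * D) := by
    refine Real.le_sqrt_of_sq_le ?_
    calc (s * RA ^ 2) ^ 2 = s ^ 2 * RA ^ 2 * RA ^ 2 := by ring
      _ = (β * RA ^ 2) * (β * RA ^ 2 + N * E / 2) := by rw [hss]; ring
      _ ≤ (β * R ^ 2) * D := by
        gcongr
        have e1 : β * RA ^ 2 ≤ β * R ^ 2 := by gcongr
        linarith
  have hr4 : r ≤ 4 * √(β * R ^ 2 * D) := by
    rw [hr]
    linarith
  have hQD : √(β * R ^ 2 * D) ≤ D := by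
    rw [Real.sqrt_le_left hD0.le]
    nlinarith
  refine ⟨by linarith, fun x hx => (h2 x hx).trans (by linarith)⟩

end Regret

/-! ### High-probability regret at a fixed scale -/

section FixedScale

variable {H Ω : Type*} [NormedAddCommGroup H] [InnerProductSpace ℝ H] [CompleteSpace H]
  {mΩ : MeasurableSpace Ω} {μ : Measure Ω} {ℱ : Filtration ℕ mΩ} {p : Seminorm ℝ H}
  {Θ : Set H} {A : OnlineAlgorithm H} {η β B R : ℝ} {N : ℕ} {emloss exloss : ℕ → Ω → H → ℝ}

lemma OnlineIL.condExp_decision [IsFiniteMeasure μ]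
    (hIL : OnlineIL μ ℱ Θ A η N emloss exloss) (hp : IsEquivalentNorm p) (hβ : 0 < β)
    (hR : ∀ x ∈ Θ, p x ≤ R) (hem : ∀ n < N, ∀ ω, CSN p β (emloss n ω))
    (hex : ∀ n < N, ∀ ω, CSN p β (exloss n ω))
    (hmem : ∀ n ω, A.decision η (fun i => emloss i ω) n ∈ Θ) {n : ℕ} (hn : n < N) :
    Integrable (fun ω => emloss n ω (A.decision η (fun i => emloss i ω) n)) μ ∧
      Integrable (fun ω => exloss n ω (A.decision η (fun i => emloss i ω) n)) μ ∧
      μ[fun ω => emloss n ω (A.decision η (fun i => emloss i ω) n) | ℱ n] =ᵐ[μ]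
        fun ω => exloss n ω (A.decision η (fun i => emloss i ω) n) :=
  condExp_eval hp hβ (ℱ.le n) hR (hem n hn) (hex n hn)
    (fun x => (hIL.emloss_meas n hn x).mono (ℱ.le _)) (hIL.exloss_meas n hn)
    (hIL.integrable n hn) (hIL.unbiased n hn) (hIL.decision_meas n hn) (hmem n)

/-- At a fixed scale `l`, with probability at least `1 - δ`, the excess expected loss over every
point of `Θ` exceeds the linearised regret on the sampled losses by at most the stated amount. The
noise `∑ ⟪ξ n, θ n - x⟫` is compared, for all `x` at once, with the scalar martingale
`∑ ⟪ξ n, θ n - y n⟫`, where `y n` is a decision of follow-the-regularised-leader on the linear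
losses `ξ`; the price is its regret. -/
lemma OnlineIL.measure_excess_le [IsProbabilityMeasure μ] [Nontrivial H]
    (hIL : OnlineIL μ ℱ Θ A η N emloss exloss) (hp : IsEquivalentNorm p) (hβ : 0 < β)
    (hB : HasGeometricConstant p B) (hcl : IsClosed Θ) (hconv : Convex ℝ Θ) (hR0 : 0 < R)
    (hR : ∀ x ∈ Θ, p x ≤ R) (hem : ∀ n < N, ∀ ω, CSN p β (emloss n ω))
    (hex : ∀ n < N, ∀ ω, CSN p β (exloss n ω))
    (hmem : ∀ n ω, A.decision η (fun i => emloss i ω) n ∈ Θ) {l δ : ℝ} (hl : 0 < l) (hδ : 0 < δ) :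
    μ {ω | ¬ ∀ x ∈ Θ,
        ∑ n ∈ Finset.range N, exloss n ω (A.decision η (fun i => emloss i ω) n)
            - ∑ n ∈ Finset.range N, exloss n ω x ≤
          ∑ n ∈ Finset.range N,
              inner ℝ (gradient (emloss n ω) (A.decision η (fun i => emloss i ω) n))
                (A.decision η (fun i => emloss i ω) n - x)
            + (B ^ 2 + Real.log (1 / δ)) / l
            + 104 * (l * (β * R ^ 2)) *
              (∑ n ∈ Finset.range N, exloss n ω (A.decision η (fun i => emloss i ω) n)
                + ∑ n ∈ Finset.range N, emloss n ω (A.decision η (fun i => emloss i ω) n))} ≤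
      ENNReal.ofReal δ := by
  rcases isEmpty_or_nonempty Ω with hΩ | ⟨⟨ω₀⟩⟩
  · rw [Set.eq_empty_of_isEmpty {ω | _}, measure_empty]
    exact zero_le
  obtain ⟨Φ, hΦc, hΦ, hftrl⟩ :=
    hB.exists_ftrl hp hcl hconv ⟨_, hmem 0 ω₀⟩ hR0 hR
  set θ : ℕ → Ω → H := fun n ω => A.decision η (fun i => emloss i ω) n with hθ
  have hθm : ∀ n < N, StronglyMeasurable[ℱ n] (θ n) := hIL.decision_meas
  set ξ : ℕ → Ω → H := fun n ω => gradient (exloss n ω) (θ n ω) - gradient (emloss n ω) (θ n ω)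
    with hξ
  set τ : ℝ := l * R ^ 2 with hτ
  have hτ0 : 0 < τ := by positivity
  set y : ℕ → Ω → H := fun n ω => Φ (∑ i ∈ Finset.range n, (-τ) • ξ i ω) with hy
  have hξm : ∀ n < N, StronglyMeasurable[ℱ (n + 1)] (ξ n) := fun n hn =>
    (stronglyMeasurable_eval (fun x => (hIL.exgrad_meas n hn x).mono (ℱ.mono n.le_succ))
      (fun ω => (hex n hn ω).continuous_gradient hp hβ) ((hθm n hn).mono (ℱ.mono n.le_succ))).sub
    (stronglyMeasurable_eval (hIL.emgrad_meas n hn)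
      (fun ω => (hem n hn ω).continuous_gradient hp hβ) ((hθm n hn).mono (ℱ.mono n.le_succ)))
  have hym : ∀ n < N, StronglyMeasurable[ℱ n] (y n) := fun n hn =>
    hΦc.comp_stronglyMeasurable (Finset.stronglyMeasurable_fun_sum _ fun i hi => by
      have hin := Finset.mem_range.1 hi
      exact ((hξm i (hin.trans hn)).mono (ℱ.mono hin)).const_smul (-τ))
  set X : ℕ → Ω → ℝ := fun n ω => inner ℝ (ξ n ω) (θ n ω - y n ω) with hX
  set V : ℕ → Ω → ℝ := fun n ω => emloss n ω (θ n ω) with hV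
  set L : ℕ → Ω → ℝ := fun n ω => exloss n ω (θ n ω) with hL
  have hV0 : ∀ n < N, ∀ ω, 0 ≤ V n ω := fun n hn ω => (hem n hn ω).nonneg _
  have hL0 : ∀ n < N, ∀ ω, 0 ≤ L n ω := fun n hn ω => (hex n hn ω).nonneg _
  have hξd : ∀ n < N, ∀ ω, dualNorm p (ξ n ω) ^ 2 ≤ 8 * β * (L n ω + V n ω) := by
    intro n hn ω
    have h1 := (hex n hn ω).dualNorm_gradient_sq_le hp hβ (θ n ω)
    have h2 := (hem n hn ω).dualNorm_gradient_sq_le hp hβ (θ n ω)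
    have h3 := hp.dualNorm_sub_le (gradient (exloss n ω) (θ n ω)) (gradient (emloss n ω) (θ n ω))
    have h4 := pow_le_pow_left₀ (dualNorm_nonneg p _) h3 2
    have h5 := add_sq_le (a := dualNorm p (gradient (exloss n ω) (θ n ω)))
      (b := dualNorm p (gradient (emloss n ω) (θ n ω)))
    simp only [hξ, hL, hV]
    linarith
  have hXq : ∀ n < N, ∀ ω, X n ω ^ 2 ≤ 32 * (β * R ^ 2) * (L n ω + V n ω) := by
    intro n hn ω
    have h1 := hp.abs_inner_le (ξ n ω) (θ n ω - y n ω)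
    have h2 : p (θ n ω - y n ω) ≤ R + R :=
      (map_sub_le_add p _ _).trans (add_le_add (hR _ (hmem n ω)) (hR _ (hΦ _)))
    calc X n ω ^ 2 = |X n ω| ^ 2 := (sq_abs _).symm
      _ ≤ (dualNorm p (ξ n ω) * p (θ n ω - y n ω)) ^ 2 := by gcongr
      _ = dualNorm p (ξ n ω) ^ 2 * p (θ n ω - y n ω) ^ 2 := mul_pow _ _ _
      _ ≤ 8 * β * (L n ω + V n ω) * (R + R) ^ 2 := by
        have := add_nonneg (hL0 n hn ω) (hV0 n hn ω)
        gcongr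
        exact hξd n hn ω
      _ = _ := by ring
  have hcond : ∀ n < N, Integrable (V n) μ ∧ Integrable (L n) μ ∧ μ[V n | ℱ n] =ᵐ[μ] L n :=
    fun n hn => hIL.condExp_decision hp hβ hR hem hex hmem hn
  have hXcond : ∀ n < N, Integrable (X n) μ ∧ μ[X n | ℱ n] =ᵐ[μ] 0 := fun n hn =>
    condExp_inner_gradient_sub hp hβ (ℱ.le n) hconv hR (hem n hn) (hex n hn)
      (fun x => (hIL.emloss_meas n hn x).mono (ℱ.le _)) (hIL.exloss_meas n hn)
      (hIL.integrable n hn) (hIL.unbiased n hn)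
      (fun x => (hIL.emgrad_meas n hn x).mono (ℱ.le _)) (hIL.exgrad_meas n hn)
      (hθm n hn) (hmem n) (hym n hn) (fun ω => hΦ _)
  obtain ⟨hZi, hZ1⟩ := integral_exp_sum_le_one (μ := μ) ℱ (N := N) (X := X) (V := V) (L := L)
    (q := 32 * (β * R ^ 2)) (by positivity)
    (fun n hn => (hξm n hn).inner
      (((hθm n hn).sub (hym n hn)).mono (ℱ.mono n.le_succ)))
    (fun n hn => stronglyMeasurable_eval (hIL.emloss_meas n hn)
      (fun ω => (hem n hn ω).differentiable.continuous) ((hθm n hn).mono (ℱ.mono n.le_succ)))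
    (fun n hn => stronglyMeasurable_eval (hIL.exloss_meas n hn)
      (fun ω => (hex n hn ω).differentiable.continuous) (hθm n hn))
    (fun n hn => (hXcond n hn).1) (fun n hn => (hcond n hn).1) (fun n hn => (hcond n hn).2.1)
    hL0 hXq (fun n hn => (hXcond n hn).2) (fun n hn => (hcond n hn).2.2) l
  refine (measure_mono ?_).trans
    (measure_le_ofReal_of_integral_le hZi (fun ω => (Real.exp_pos _).le) one_pos hδ hZ1)
  intro ω hω
  by_contra hlt
  refine hω fun x hx => ?_
  have hlt' := Real.log_lt_log (Real.exp_pos _) (not_le.1 hlt)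
  rw [Real.log_exp, Finset.sum_sub_distrib, ← Finset.mul_sum, ← Finset.mul_sum,
    Finset.sum_add_distrib, ← Finset.mul_sum] at hlt'
  change ∑ n ∈ Finset.range N, L n ω - ∑ n ∈ Finset.range N, exloss n ω x ≤
    ∑ n ∈ Finset.range N, inner ℝ (gradient (emloss n ω) (θ n ω)) (θ n ω - x)
      + (B ^ 2 + Real.log (1 / δ)) / l
      + 104 * (l * (β * R ^ 2)) * (∑ n ∈ Finset.range N, L n ω + ∑ n ∈ Finset.range N, V n ω)
  have hconvex : ∑ n ∈ Finset.range N, L n ω - ∑ n ∈ Finset.range N, exloss n ω x ≤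
      ∑ n ∈ Finset.range N, inner ℝ (gradient (emloss n ω) (θ n ω)) (θ n ω - x) +
        ∑ n ∈ Finset.range N, X n ω + ∑ n ∈ Finset.range N, inner ℝ (ξ n ω) (y n ω - x) := by
    rw [← Finset.sum_sub_distrib, ← Finset.sum_add_distrib, ← Finset.sum_add_distrib]
    refine Finset.sum_le_sum fun n hn => ?_
    refine ((hex n (Finset.mem_range.1 hn) ω).sub_le_inner (θ n ω) x).trans_eq ?_
    simp only [hX, hξ, inner_sub_left, inner_sub_right]
    ring
  have hreg := hftrl (fun n => (-τ) • ξ n ω) N x hx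
  have e1 : ∑ n ∈ Finset.range N, inner ℝ ((-τ) • ξ n ω)
      (x - Φ (∑ i ∈ Finset.range n, (-τ) • ξ i ω)) =
      τ * ∑ n ∈ Finset.range N, inner ℝ (ξ n ω) (y n ω - x) := by
    rw [Finset.mul_sum]
    refine Finset.sum_congr rfl fun n _ => ?_
    rw [inner_smul_left, ← neg_sub _ x, inner_neg_right]
    simp [hy]
  have e2 : ∑ n ∈ Finset.range N, dualNorm p ((-τ) • ξ n ω) ^ 2 ≤
      τ ^ 2 * (8 * β * (∑ n ∈ Finset.range N, L n ω + ∑ n ∈ Finset.range N, V n ω)) := by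
    rw [← Finset.sum_add_distrib, Finset.mul_sum, Finset.mul_sum]
    refine Finset.sum_le_sum fun n hn => ?_
    have h1 := pow_le_pow_left₀ (dualNorm_nonneg p _) (hp.dualNorm_smul_le (-τ) (ξ n ω)) 2
    rw [abs_neg, abs_of_pos hτ0, mul_pow] at h1
    exact h1.trans (mul_le_mul_of_nonneg_left (hξd n (Finset.mem_range.1 hn) ω) (sq_nonneg τ))
  rw [e1] at hreg
  have hSL : 0 ≤ ∑ n ∈ Finset.range N, L n ω :=
    Finset.sum_nonneg fun n hn => hL0 n (Finset.mem_range.1 hn) ω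
  have hSV : 0 ≤ ∑ n ∈ Finset.range N, V n ω :=
    Finset.sum_nonneg fun n hn => hV0 n (Finset.mem_range.1 hn) ω
  generalize ∑ n ∈ Finset.range N, inner ℝ (ξ n ω) (y n ω - x) = Y at hreg hconvex
  generalize ∑ n ∈ Finset.range N, inner ℝ (gradient (emloss n ω) (θ n ω)) (θ n ω - x) = J
    at hconvex ⊢
  generalize ∑ n ∈ Finset.range N, exloss n ω x = T at hconvex ⊢
  generalize ∑ n ∈ Finset.range N, X n ω = M at hconvex hlt'
  generalize ∑ n ∈ Finset.range N, L n ω = S at *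
  generalize ∑ n ∈ Finset.range N, V n ω = U at *
  have hY : l * Y ≤ B ^ 2 + 8 * (l ^ 2 * (β * R ^ 2)) * (S + U) := by
    have h1 := hreg.trans (add_le_add_right e2 (B ^ 2 * R ^ 2))
    have hR2 : 0 < R ^ 2 := by positivity
    refine le_of_mul_le_mul_left ?_ hR2
    calc R ^ 2 * (l * Y) = τ * Y := by rw [hτ]; ring
      _ ≤ _ := h1
      _ = _ := by rw [hτ]; ring
  have hM : l * (M + Y) ≤ B ^ 2 + Real.log (1 / δ) + l * (104 * (l * (β * R ^ 2)) * (S + U)) := by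
    have : 0 ≤ l ^ 2 * (β * R ^ 2) * U := by positivity
    nlinarith
  have hfin : M + Y ≤ (B ^ 2 + Real.log (1 / δ)) / l + 104 * (l * (β * R ^ 2)) * (S + U) := by
    rw [← sub_le_iff_le_add, le_div_iff₀ hl]
    linarith
  linarith

end FixedScale

/-! ### Choice of the scale -/

section Assembly

/-- Solving the self-bounding inequality for the excess loss `S - T` at the scale `w * D` that
matches `T + D` up to a factor `2`. -/
lemma excess_le_of_scale {B b ℓ D S T w ℓw l : ℝ} (hb : 0 < b) (hℓ : 1 ≤ ℓ) (hD : b * ℓ ≤ D)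
    (hT : 0 ≤ T) (hTS : T ≤ S) (hw : 1 ≤ w) (hw1 : w * D ≤ T + D) (hw2 : T + D ≤ 2 * (w * D))
    (hl : l = √(ℓ * b * (w * D)) / (208 * b * (w * D))) (hℓw : ℓw ≤ 85 * ℓ)
    (h : S - T ≤ 12 * √(b * D) + (B ^ 2 + ℓw) / l + 104 * (l * b) * (S + 10 * D)) :
    S - T ≤ 416 * (B ^ 2 + 86) * √(ℓ * b * (T + D)) := by
  have hℓ0 : 0 < ℓ := by linarith
  have hD0 : 0 < D := lt_of_lt_of_le (by positivity) hD
  have hwD : 0 < w * D := by positivity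
  set v := √(ℓ * b * (w * D)) with hv
  have hv0 : 0 < v := Real.sqrt_pos.2 (by positivity)
  have hv2 : v ^ 2 = ℓ * b * (w * D) := Real.sq_sqrt (by positivity)
  have hvP : v ≤ √(ℓ * b * (T + D)) := Real.sqrt_le_sqrt (by gcongr)
  have hDP : √(b * D) ≤ √(ℓ * b * (T + D)) := Real.sqrt_le_sqrt (by
    have h1 : 1 * b * D ≤ ℓ * b * (T + D) := by
      gcongr
      linarith
    linarith)
  have hDw : D ≤ w * D := by nlinarith
  have hvw : v ≤ w * D := by
    rw [hv, Real.sqrt_le_left hwD.le, sq]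
    refine mul_le_mul_of_nonneg_right ?_ hwD.le
    linarith
  have e1 : (B ^ 2 + ℓw) / l ≤ 208 * (B ^ 2 + 85) * v := by
    have h1 : (B ^ 2 + ℓw) / l = (B ^ 2 + ℓw) * (208 * v / ℓ) := by
      have h2 : 1 / l = 208 * v / ℓ := by
        rw [hl, one_div_div, div_eq_div_iff hv0.ne' hℓ0.ne']
        linear_combination -208 * hv2
      rw [div_eq_mul_one_div, h2]
    rw [h1]
    have h3 : B ^ 2 + ℓw ≤ (B ^ 2 + 85) * ℓ := by nlinarith [sq_nonneg B]
    calc _ ≤ (B ^ 2 + 85) * ℓ * (208 * v / ℓ) := by gcongr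
      _ = _ := by field_simp
  have e2 : 104 * (l * b) = v / (2 * (w * D)) := by
    rw [hl]
    field_simp
    norm_num
  have e3 : v / (2 * (w * D)) * (S - T) ≤ 1 / 2 * (S - T) := by
    have : v / (2 * (w * D)) ≤ 1 / 2 := by
      rw [div_le_div_iff₀ (by positivity) two_pos]
      linarith
    exact mul_le_mul_of_nonneg_right this (by linarith)
  have e4 : v / (2 * (w * D)) * (T + 10 * D) ≤ 10 * v := by
    calc _ ≤ v / (2 * (w * D)) * (10 * (2 * (w * D))) := by
          gcongr
          linarith
      _ = _ := by field_simp
  rw [e2] at h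
  have e5 : v / (2 * (w * D)) * (S + 10 * D) =
    v / (2 * (w * D)) * (S - T) + v / (2 * (w * D)) * (T + 10 * D) := by ring
  have e6 : (208 * (B ^ 2 + 85) + 10) * v ≤
      (208 * (B ^ 2 + 85) + 10) * √(ℓ * b * (T + D)) := by gcongr
  nlinarith [sq_nonneg B, Real.sqrt_nonneg (ℓ * b * (T + D))]

/-- The average excess loss, from the total excess loss. -/
lemma average_excess_le {K b ℓ C N E S T : ℝ} (hK : 0 ≤ K) (hb : 0 ≤ b) (hℓ : 0 ≤ ℓ) (hC : ℓ ≤ C)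
    (hN : 0 < N) (hE : 0 ≤ E) (hT : 0 ≤ T)
    (h : S - T ≤ K * √(ℓ * b * (T + (N * E + b * ℓ)))) :
    1 / N * S - 1 / N * T ≤ K * (C * b / N + √(C * b * (E + 1 / N * T) / N)) := by
  have h1 : √(ℓ * b * (T + (N * E + b * ℓ))) ≤ √(C * b * (N * E + T)) + C * b := by
    have e1 : ℓ * b * (T + (N * E + b * ℓ)) = ℓ * b * (N * E + T) + (ℓ * b) ^ 2 := by ring
    have e2 : 0 ≤ N * E + T := by positivity
    have e3 : √(ℓ * b * (N * E + T)) ≤ √(C * b * (N * E + T)) := Real.sqrt_le_sqrt (by gcongr)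
    have e4 : ℓ * b ≤ C * b := by gcongr
    have e5 : 0 ≤ ℓ * b := by positivity
    refine le_trans (Real.sqrt_le_iff.2 ⟨by positivity, ?_⟩) (add_le_add e3 e4)
    have e6 := Real.sq_sqrt (mul_nonneg e5 e2)
    have e7 := mul_nonneg (Real.sqrt_nonneg (ℓ * b * (N * E + T))) e5
    rw [e1]
    linarith
  have h2 : √(C * b * (E + 1 / N * T) / N) = √(C * b * (N * E + T)) / N := by
    rw [← Real.sqrt_sq hN.le, ← Real.sqrt_div' _ (by positivity), Real.sqrt_sq hN.le]
    congr 1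
    field_simp
  rw [h2, ← mul_sub, ← add_div, mul_div_assoc', one_div_mul_eq_div]
  gcongr
  refine h.trans (mul_le_mul_of_nonneg_left ?_ hK)
  linarith

end Assembly

/-! ### The high-probability bound -/

theorem theorem2 (B : ℝ) :
    ∃ K : ℝ, 0 < K ∧
      ∀ (H : Type*) [NormedAddCommGroup H] [InnerProductSpace ℝ H] [CompleteSpace H]
        (p : Seminorm ℝ H) (_ : IsEquivalentNorm p) (_ : HasGeometricConstant p B)
        (Θ : Set H) (_ : IsClosed Θ) (_ : Convex ℝ Θ)
        (RΘ : ℝ) (_ : ∀ x ∈ Θ, p x ≤ RΘ)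
        (A : OnlineAlgorithm H) (RA : ℝ) (_ : 0 ≤ RA) (_ : IsAdmissible p Θ A RA)
        (Ω : Type*) (mΩ : MeasurableSpace Ω) (μ : Measure Ω) [IsProbabilityMeasure μ]
        (ℱ : Filtration ℕ mΩ) (N : ℕ) (_ : 1 ≤ N) (β : ℝ) (_ : 0 < β) (Ehat : ℝ)
        (emloss exloss : ℕ → Ω → H → ℝ)
        (_ : OnlineIL μ ℱ Θ A (stepsize β N Ehat RA) N emloss exloss)
        (_ : ∀ n < N, ∀ ω, CSN p β (emloss n ω))
        (_ : ∀ n < N, ∀ ω, CSN p β (exloss n ω))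
        (_ : ∀ᵐ ω ∂μ, bias Θ N (fun n => emloss n ω) ≤ Ehat)
        (G : ℝ) (_ : 0 ≤ G)
        (_ : ∀ n < N, ∀ ω, ∀ x ∈ Θ, dualNorm p (gradient (emloss n ω) x) ≤ G)
        (δ : ℝ) (_ : 0 < δ) (_ : δ < 1 / Real.exp 1)
        (R : ℝ) (_ : R = max 1 (max RΘ RA))
        (C : ℝ) (_ : C = Real.log (1 / δ) * max 1 (Real.log (G * R * N))),
        μ {ω | ¬ ((1 / (N : ℝ)) * ∑ n ∈ Finset.range N,
                exloss n ω
                  (A.decision (stepsize β N Ehat RA) (fun i => emloss i ω) n)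
              - bias Θ N (fun n => exloss n ω) ≤
            K * (C * β * R ^ 2 / N +
              √(C * β * R ^ 2 * (Ehat + bias Θ N (fun n => exloss n ω)) / N)))}
          ≤ ENNReal.ofReal δ := by
  refine ⟨416 * (B ^ 2 + 86), by positivity, ?_⟩
  intro H _ _ _ p hp hB Θ hcl hconv RΘ hRΘ A RA hRA0 hA Ω mΩ μ _ ℱ N hN β hβ E emloss exloss hIL
    hem hex hE G _ _ δ hδ hδe R hR C hC
  set K := 416 * (B ^ 2 + 86) with hK
  have hK0 : 0 < K := by positivity
  set η := stepsize β N E RA with hη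
  have hmem : ∀ n ω, A.decision η (fun i => emloss i ω) n ∈ Θ := fun n ω =>
    hA.mem η (stepsize_pos hβ E) _
  have hNpos : (0 : ℝ) < N := by exact_mod_cast hN
  set ℓ := Real.log (1 / δ) with hℓ
  have hℓ1 : 1 ≤ ℓ := by
    rw [hℓ, Real.le_log_iff_exp_le (by positivity), le_div_iff₀ hδ, mul_comm,
      ← le_div_iff₀ (Real.exp_pos 1)]
    exact hδe.le
  have hCℓ : ℓ ≤ C := by
    rw [hC]
    exact le_mul_of_one_le_right (by linarith) (le_max_left _ _)
  have hC0 : 0 ≤ C := by linarith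
  have hR1 : 1 ≤ R := hR ▸ le_max_left _ _
  have hRΘR : RΘ ≤ R := hR ▸ (le_max_left _ _).trans (le_max_right _ _)
  have hRAR : RA ≤ R := hR ▸ (le_max_right _ _).trans (le_max_right _ _)
  have hRp : ∀ x ∈ Θ, p x ≤ R := fun x hx => (hRΘ x hx).trans hRΘR
  rcases Θ.subsingleton_or_nontrivial with hsub | hnt
  · -- All decisions coincide with the best one.
    suffices h : {ω | ¬ ((1 / (N : ℝ)) * ∑ n ∈ Finset.range N,
        exloss n ω (A.decision η (fun i => emloss i ω) n) - bias Θ N (fun n => exloss n ω) ≤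
          K * (C * β * R ^ 2 / N +
            √(C * β * R ^ 2 * (E + bias Θ N (fun n => exloss n ω)) / N)))} = ∅ by
      rw [h, measure_empty]
      exact zero_le
    refine Set.eq_empty_iff_forall_notMem.2 fun ω hω => hω ?_
    have h1 : ∑ n ∈ Finset.range N, exloss n ω (A.decision η (fun i => emloss i ω) n) ≤
        minTotalLoss Θ N (fun n => exloss n ω) :=
      le_minTotalLoss ⟨_, hmem 0 ω⟩ fun x hx =>
        Finset.sum_le_sum fun n _ => by rw [hsub (hmem n ω) hx]
    have h2 : 0 ≤ K * (C * β * R ^ 2 / N +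
        √(C * β * R ^ 2 * (E + bias Θ N (fun n => exloss n ω)) / N)) := by positivity
    have h3 := mul_le_mul_of_nonneg_left h1 (one_div_nonneg.2 hNpos.le)
    unfold bias at h2 ⊢
    linarith
  obtain ⟨a, ha, a', ha', haa'⟩ := hnt
  have : Nontrivial H := ⟨a, a', haa'⟩
  have hRA : 0 < RA := by
    refine hRA0.lt_of_ne fun h => haa' ?_
    exact (h ▸ hA).subsingleton hp hRΘ ha ha'
  have hE0 : 0 ≤ E := by
    obtain ⟨ω, hω⟩ := hE.exists
    exact (bias_nonneg fun n hn x => (hem n hn ω).nonneg x).trans hω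
  set b := β * R ^ 2 with hb
  have hb0 : 0 < b := by positivity
  set D := N * E + b * ℓ with hD
  have hNE : 0 ≤ N * E := by positivity
  have hbD : b * ℓ ≤ D := by linarith
  have hbℓ : b ≤ b * ℓ := le_mul_of_one_le_right hb0.le hℓ1
  have hD0 : 0 < D := by linarith
  -- The sampled losses and the linearised regret are controlled almost surely.
  have hdet : ∀ᵐ ω ∂μ, ∑ n ∈ Finset.range N,
        emloss n ω (A.decision η (fun i => emloss i ω) n) ≤ 10 * D ∧
      ∀ x ∈ Θ, ∑ n ∈ Finset.range N,
          inner ℝ (gradient (emloss n ω) (A.decision η (fun i => emloss i ω) n))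
            (A.decision η (fun i => emloss i ω) n - x) ≤ 12 * √(b * D) := by
    filter_upwards [hE] with ω hω
    refine hA.regret_stepsize_le (f := fun n => emloss n ω) hp hβ hRΘ hRA hRAR hE0
      (fun n hn => hem n hn ω) ?_ (by linarith)
    unfold bias at hω
    rw [one_div_mul_eq_div, div_le_iff₀ hNpos] at hω
    linarith
  set S : Ω → ℝ := fun ω => ∑ n ∈ Finset.range N,
    exloss n ω (A.decision η (fun i => emloss i ω) n) with hS
  have hcond : ∀ n < N, _ := fun n hn => hIL.condExp_decision hp hβ hRp hem hex hmem hn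
  have hSi : Integrable S μ :=
    integrable_finsetSum _ fun n hn => (hcond n (Finset.mem_range.1 hn)).2.1
  have hS0 : ∀ ω, 0 ≤ S ω := fun ω =>
    Finset.sum_nonneg fun n hn => (hex n (Finset.mem_range.1 hn) ω).nonneg _
  have hSE : ∫ ω, S ω ∂μ ≤ 10 * D := by
    have h1 : ∫ ω, S ω ∂μ = ∫ ω, ∑ n ∈ Finset.range N,
        emloss n ω (A.decision η (fun i => emloss i ω) n) ∂μ := by
      rw [hS, integral_finsetSum _ fun n hn => (hcond n (Finset.mem_range.1 hn)).2.1,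
        integral_finsetSum _ fun n hn => (hcond n (Finset.mem_range.1 hn)).1]
      refine Finset.sum_congr rfl fun n hn => ?_
      rw [← integral_congr_ae (hcond n (Finset.mem_range.1 hn)).2.2, integral_condExp]
    rw [h1]
    have h2 := integral_mono_ae
      (integrable_finsetSum (Finset.range N) fun n hn => (hcond n (Finset.mem_range.1 hn)).1)
      (integrable_const (μ := μ) (10 * D)) (hdet.mono fun ω h => h.1)
    simpa using h2
  have hmarkov := measure_le_ofReal_of_integral_le hSi hS0 (by positivity : 0 < 10 * D)
    (half_pos hδ) hSE
  -- One scale for each dyadic value of `T + D`, with summable failure probabilities.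
  set l : ℕ → ℝ := fun j => √(ℓ * b * (2 ^ j * D)) / (208 * b * (2 ^ j * D)) with hl
  have hl0 : ∀ j, 0 < l j := fun j => div_pos (Real.sqrt_pos.2 (by positivity)) (by positivity)
  have hscale : ∀ j : ℕ, _ := fun j => hIL.measure_excess_le (μ := μ) hp hβ hB hcl hconv
    (by linarith : 0 < R) hRp hem hex hmem (hl0 j) (by positivity : 0 < δ / 2 / 2 / 2 ^ j)
  have hunion := (measure_iUnion_le _).trans (ENNReal.tsum_le_tsum hscale)
  rw [← ENNReal.ofReal_tsum_of_nonneg (fun j => by positivity)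
    (hasSum_geometric_two' (δ / 2)).summable, tsum_geometric_two'] at hunion
  have hall := (measure_union_le _ _).trans
    (add_le_add (measure_union_le _ _) le_rfl |>.trans
      (add_le_add (add_le_add (ae_iff.1 hdet).le hmarkov) hunion))
  rw [zero_add, ← ENNReal.ofReal_add (by positivity) (by positivity), add_halves] at hall
  refine (measure_mono fun ω hω => ?_).trans hall
  by_contra hgood
  simp only [Set.mem_union, Set.mem_iUnion, Set.mem_ofPred_eq, not_or, not_not, not_exists] at hgood
  obtain ⟨⟨⟨hU, hJ⟩, hSD⟩, hgood⟩ := hgood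
  refine hω ?_
  set T := minTotalLoss Θ N (fun n => exloss n ω) with hT
  have hexn : ∀ n < N, ∀ x, 0 ≤ exloss n ω x := fun n hn x => (hex n hn ω).nonneg x
  have hT0 : 0 ≤ T := minTotalLoss_nonneg hexn
  obtain ⟨j, hj1, hj2⟩ := exists_nat_pow_near (x := (T + D) / D) (y := 2)
    ((one_le_div hD0).2 (by linarith)) one_lt_two
  rw [le_div_iff₀ hD0] at hj1
  rw [div_lt_iff₀ hD0, pow_succ] at hj2
  have hmain : S ω - (12 * √(b * D) + (B ^ 2 + Real.log (1 / (δ / 2 / 2 / 2 ^ j))) / l j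
      + 104 * (l j * b) * (S ω + 10 * D)) ≤ T := by
    refine le_minTotalLoss ⟨a, ha⟩ fun x hx => ?_
    have h1 := hgood j x hx
    have h2 := hJ x hx
    have h3 : 104 * (l j * b) * (S ω + ∑ n ∈ Finset.range N,
        emloss n ω (A.decision η (fun i => emloss i ω) n)) ≤
        104 * (l j * b) * (S ω + 10 * D) := by
      have := (hl0 j).le
      gcongr
    linarith
  have hfinal : S ω - T ≤ K * √(ℓ * b * (T + D)) := by
    -- The regret against a fixed comparator may be negative.
    rcases le_total (S ω) T with hST | hTS
    · exact (sub_nonpos.2 hST).trans (by positivity)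
    refine excess_le_of_scale (w := 2 ^ j) (l := l j) hb0 hℓ1 hbD hT0 hTS
      (one_le_pow₀ one_le_two) hj1 (by linarith) rfl ?_ (sub_le_comm.1 hmain)
    have h1 : (2 : ℝ) ^ j ≤ 21 / δ := by
      have e1 : S ω ≤ 20 * D / δ := by
        have : 10 * D / (δ / 2) = 20 * D / δ := by
          field_simp
          norm_num
        linarith [not_le.1 hSD]
      have e2 : D ≤ D / δ := by
        rw [le_div_iff₀ hδ]
        have : δ ≤ 1 := hδe.le.trans (by
          rw [div_le_one (Real.exp_pos 1)]
          exact Real.one_le_exp zero_le_one)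
        nlinarith
      have e3 : 2 ^ j * D ≤ 21 / δ * D := by
        have : 21 / δ * D = 20 * D / δ + D / δ := by ring
        linarith
      exact le_of_mul_le_mul_right e3 hD0
    have h2 : 1 / (δ / 2 / 2 / 2 ^ j) ≤ 84 * (1 / δ) ^ 2 := by
      calc 1 / (δ / 2 / 2 / 2 ^ j) = 4 / δ * 2 ^ j := by
            field_simp
            norm_num
        _ ≤ 4 / δ * (21 / δ) := by gcongr
        _ = _ := by
            field_simp
            norm_num
    have h3 := Real.log_le_log (by positivity) h2
    rw [Real.log_mul (by norm_num) (by positivity), Real.log_pow, ← hℓ] at h3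
    have h4 := Real.log_le_sub_one_of_pos (show (0 : ℝ) < 84 by norm_num)
    push_cast at h3
    linarith
  have h := average_excess_le hK0.le hb0.le (by linarith) hCℓ hNpos hE0 hT0 hfinal
  rwa [hb, ← mul_assoc] at h
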